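/- All vector spaces are finite-dimensional and real. A *linear $2$-groupoid* is a simplicial vector space $V_\bullet$ (face maps $f_i$, degeneracy maps $\sigma_i$) whose horn maps $\lambda_{q,k}:V_q\to\Lambda_{q,k}V$, $x\mapsto(f_ix)_{i\ne k}$, are surjective for $q\ge 1$ and bijective for $q>2$. For a $2$-form $\omega$ on $V_2$ and $x\in V_0$ put, with $\omega$ evaluated at the point $\sigma_0\sigma_0x$, $$A_\omega(v,w)=\omega(\sigma_0\sigma_0v,w)\quad (v\in V_0,\ w\in V_2),\qquad B_\omega(\theta,\eta)=\omega(\sigma_1\theta,\sigma_0\eta)+\omega(\sigma_1\eta,\sigma_0\theta)\quad(\theta,\eta\in V_1).$$ Let $\delta=\sum_i(-1)^if_i^*$. A *constant symplectic $2$-groupoid* $(V_\bullet,\omega)$ is a linear $2$-groupoid with a constant $2$-form $\omega$ on $V_2$ that is closed, multiplicative ($\delta\omega=0$), normalized ($\sigma_i^*\omega=0$ for all $i$) and simplicially nondegenerate (at each $x \in V_0$ the pairings induced by $A_\omega$ on $V_0\times V_2/\sum_i\sigma_i(V_1)$ and by $B_\omega$ on $V_1/\sigma_0(V_0)$ are nondegenerate).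 Two such forms $\omega,\omega'$ on the same $V_\bullet$ are *equivalent* if $\omega'-\omega=\delta\alpha$ for some closed normalized (smooth, not necessarily constant) $2$-form $\alpha$ on $V_1$ with $A_{\delta\alpha}=B_{\delta\alpha}=0$. $(V_\bullet,\omega)$ and $(V'_\bullet,\omega')$ are in the same equivalence class if there is an isomorphism $\varphi:V_\bullet\to V'_\bullet$ of simplicial vector spaces with $\omega$ equivalent to $\varphi^*\omega'$. **Theorem 3.6.** There is a one-to-one correspondence between equivalence classes of constant symplectic $2$-groupoids and isomorphism classes of tuples $(W_1,W_0,\langle\cdot,\cdot\rangle,\partial)$, where - $W_1$ and $W_0$ are vector spaces, - $\langle\cdot,\cdot\rangle$ is a nondegenerate symmetric bilinear form on $W_1$, - $\partial:W_1\to W_0$ is a linear map such that the image of $\partial^*:W_0^*\to W_1^*\cong W_1$ is isotropic. The correspondence sends the class of $(V_\bullet,\omega)$ to the class of $W_1=\ker(f_0:V_1\to V_0)$, $W_0=V_0$, $\langle w,w'\rangle=B_\omega(w,w')$, $\partial w=-f_1w$. Moreover, let $(V_\bullet,\omega)$ be a constant symplectic $2$-groupoid. A constant $2$-form $\omega'$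 that also makes $V_\bullet$ a constant symplectic $2$-groupoid is equivalent to $\omega$ if and only if $A_{\omega'}=A_\omega$ and $B_{\omega'}=B_\omega$. For every $r\in\wedge^2W_1^*$ there is exactly one such $\omega'$ equivalent to $\omega$ for which $r$ is the skew-symmetric part of the bilinear form $(w,w')\mapsto\omega'(\sigma_1w,\ \sigma_0w'-\sigma_1w')$ on $W_1$. -/

import Mathlib

open CategoryTheory Simplicial

universe u

noncomputable section

namespace ConstSymp

/-! ### Differential 2-forms on real vector spaces

A (not necessarily constant) field of bilinear forms on `E` is a function `E → BilinForm ℝ E`;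
the tangent space at every point of `E` is `E` itself. -/

section Forms

variable {E F : Type*} [AddCommGroup E] [Module ℝ E] [AddCommGroup F] [Module ℝ F]

/-- Smoothness of a function on a (finite-dimensional) real vector space, tested on all linear
parametrisations by some `ℝⁿ`; for finite-dimensional `E` this is smoothness in one (equivalently
every) linear chart. -/
def SmoothFun (g : E → ℝ) : Prop :=
  ∀ (n : ℕ) (φ : (Fin n → ℝ) →ₗ[ℝ] E), ContDiff ℝ (⊤ : ℕ∞) (fun c => g (φ c))

/-- Smooth differential 2-forms. -/
structure IsTwoForm (α : E → LinearMap.BilinForm ℝ E) : Prop where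
  alt : ∀ x, (α x).IsAlt
  smooth : ∀ v w, SmoothFun (fun x => α x v w)

/-- `dα = 0`: the exterior derivative evaluated on the constant vector fields `u`, `v`, `w`. -/
def ClosedForm (α : E → LinearMap.BilinForm ℝ E) : Prop :=
  ∀ x u v w : E,
    lineDeriv ℝ (fun y => α y v w) x u - lineDeriv ℝ (fun y => α y u w) x v
      + lineDeriv ℝ (fun y => α y u v) x w = 0

/-- Pullback `f^* α` along a linear map `f` (which is its own differential). -/
def pullback (f : E →ₗ[ℝ] F) (α : F → LinearMap.BilinForm ℝ F) : E → LinearMap.BilinForm ℝ E :=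
  fun x => (α (f x)).comp f f

/-- The constant field with value `ω`. -/
def constForm (ω : LinearMap.BilinForm ℝ E) : E → LinearMap.BilinForm ℝ E := fun _ => ω

end Forms

/-! ### Linear 2-groupoids -/

/-- Simplicial real vector spaces. -/
abbrev SVect : Type (u + 1) := SimplicialObject (ModuleCat.{u} ℝ)

/-- The face map `f_i : V_{n+1} → V_n`. -/
def face (V : SVect.{u}) {n : ℕ} (i : Fin (n + 2)) : V _⦋n + 1⦌ →ₗ[ℝ] V _⦋n⦌ := (V.δ i).hom

/-- The degeneracy map `σ_i : V_n → V_{n+1}`. -/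
def degen (V : SVect.{u}) {n : ℕ} (i : Fin (n + 1)) : V _⦋n⦌ →ₗ[ℝ] V _⦋n + 1⦌ := (V.σ i).hom

/-- The space of `(n+1, k)`-horns: families `(x_i)_{i ≠ k}` in `V_n` with
`f_i x_j = f_{j-1} x_i` for `i < j` (here `i` is `a.castSucc` and `j` is `b.succ` with `a ≤ b`).
There is no compatibility condition for `(1, k)`-horns. -/
def hornSpace (V : SVect.{u}) (n : ℕ) (k : Fin (n + 2)) :
    Set ({i : Fin (n + 2) // i ≠ k} → V _⦋n⦌) :=
  match n, k with
  | 0, _ => Set.univ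
  | _ + 1, k => {x | ∀ a b, a ≤ b → ∀ (ha : a.castSucc ≠ k) (hb : b.succ ≠ k),
      face V a (x ⟨b.succ, hb⟩) = face V b (x ⟨a.castSucc, ha⟩)}

/-- The horn map `λ_{n+1,k}`, which omits the `k`-th face. -/
def hornMap (V : SVect.{u}) (n : ℕ) (k : Fin (n + 2)) (x : V _⦋n + 1⦌) :
    {i : Fin (n + 2) // i ≠ k} → V _⦋n⦌ :=
  fun i => face V i.1 x

/-- Linear 2-groupoids: Lie 2-groupoids whose spaces are (finite-dimensional) vector spaces and
whose structure maps are linear. For linear maps, surjective submersions are the surjective maps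
and diffeomorphisms are the bijective maps; face maps are automatically surjective and
degeneracy maps automatically injective, by the simplicial identities. -/
structure IsLinearTwoGroupoid (V : SVect.{u}) : Prop where
  finite : ∀ n, FiniteDimensional ℝ (V _⦋n⦌)
  horn_surj : ∀ (n : ℕ) (k : Fin (n + 2)),
    Set.SurjOn (hornMap V n k) Set.univ (hornSpace V n k)
  horn_bij : ∀ (n : ℕ) (k : Fin (n + 2)), 2 < n + 1 →
    Set.BijOn (hornMap V n k) Set.univ (hornSpace V n k)

/-! ### Forms on simplicial vector spaces -/

/-- The simplicial coboundary `δα = ∑ (-1)^i f_i^* α`. -/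
def cobdry (V : SVect.{u}) {n : ℕ} (α : V _⦋n⦌ → LinearMap.BilinForm ℝ (V _⦋n⦌)) :
    V _⦋n + 1⦌ → LinearMap.BilinForm ℝ (V _⦋n + 1⦌) :=
  fun x => ∑ i : Fin (n + 2), (-1 : ℝ) ^ (i : ℕ) • pullback (face V i) α x

/-- Multiplicative: `δα = 0`. -/
def Multiplicative (V : SVect.{u}) {n : ℕ} (α : V _⦋n⦌ → LinearMap.BilinForm ℝ (V _⦋n⦌)) : Prop :=
  ∀ x, cobdry V α x = 0

/-- Normalized: all pullbacks by degeneracy maps vanish. -/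
def Normalized (V : SVect.{u}) {n : ℕ}
    (α : V _⦋n + 1⦌ → LinearMap.BilinForm ℝ (V _⦋n + 1⦌)) : Prop :=
  ∀ (i : Fin (n + 1)) x, pullback (degen V i) α x = 0

/-- The sum of the degenerate subspaces of `V_{n+1}`; the quotient by it is the term of the tangent
complex in degree `n + 1`. -/
def degenerate (V : SVect.{u}) (n : ℕ) : Submodule ℝ (V _⦋n + 1⦌) :=
  ⨆ i : Fin (n + 1), LinearMap.range (degen V i)

/-- The iterated degeneracy `σ² = σ_0 σ_0 : V_0 → V_2`. -/
def unit2 (V : SVect.{u}) : V _⦋0⦌ →ₗ[ℝ] V _⦋2⦌ :=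
  (degen V (n := 1) 0).comp (degen V (n := 0) 0)

/-- `Ã_ω(v, w) = ω(σ² v, w)` at the point `x ∈ V_0`. -/
def pairA (V : SVect.{u}) (ω : V _⦋2⦌ → LinearMap.BilinForm ℝ (V _⦋2⦌))
    (x v : V _⦋0⦌) (w : V _⦋2⦌) : ℝ :=
  ω (unit2 V x) (unit2 V v) w

/-- `B̃_ω(θ, η) = ω(σ_1 θ, σ_0 η) + ω(σ_1 η, σ_0 θ)` at the point `x ∈ V_0`. -/
def pairB (V : SVect.{u}) (ω : V _⦋2⦌ → LinearMap.BilinForm ℝ (V _⦋2⦌))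
    (x : V _⦋0⦌) (θ η : V _⦋1⦌) : ℝ :=
  ω (unit2 V x) (degen V (n := 1) 1 θ) (degen V (n := 1) 0 η)
    + ω (unit2 V x) (degen V (n := 1) 1 η) (degen V (n := 1) 0 θ)

/-- Simplicial nondegeneracy of a normalized form: at every `x ∈ V_0`, the pairing induced by `Ã_ω`
between `V_0` and `V_2 / degenerate` and the symmetric form induced by `B̃_ω` on
`V_1 / degenerate` are nondegenerate. -/
structure SimpliciallyNondegenerate (V : SVect.{u})
    (ω : V _⦋2⦌ → LinearMap.BilinForm ℝ (V _⦋2⦌)) : Prop where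
  left_A : ∀ x v, (∀ w, pairA V ω x v w = 0) → v = 0
  right_A : ∀ x w, (∀ v, pairA V ω x v w = 0) → w ∈ degenerate V 1
  nondeg_B : ∀ x θ, (∀ η, pairB V ω x θ η = 0) → θ ∈ degenerate V 0

/-- The 2-forms that make a linear 2-groupoid a symplectic 2-groupoid. -/
structure IsSymplecticForm (V : SVect.{u})
    (ω : V _⦋2⦌ → LinearMap.BilinForm ℝ (V _⦋2⦌)) : Prop where
  form : IsTwoForm ω
  closed : ClosedForm ω
  mult : Multiplicative V ω
  normalized : Normalized V (n := 1) ω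
  nondeg : SimpliciallyNondegenerate V ω

/-- Equivalence of 2-forms on `V_2`: `ω' - ω = δα` for a closed normalized 2-form `α` on `V_1`
(not assumed constant) with `A_{δα} = 0` and `B_{δα} = 0`. -/
def FormEquiv (V : SVect.{u}) (ω ω' : V _⦋2⦌ → LinearMap.BilinForm ℝ (V _⦋2⦌)) : Prop :=
  ∃ α : V _⦋1⦌ → LinearMap.BilinForm ℝ (V _⦋1⦌),
    IsTwoForm α ∧ ClosedForm α ∧ Normalized V (n := 0) α ∧
    (∀ x, ω' x - ω x = cobdry V α x) ∧
    (∀ x v w, pairA V (cobdry V α) x v w = 0) ∧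
    (∀ x θ η, pairB V (cobdry V α) x θ η = 0)

/-! ### Constant symplectic 2-groupoids -/

/-- A constant symplectic 2-groupoid. -/
structure ConstSympGpd : Type (u + 1) where
  V : SVect.{u}
  isLinear : IsLinearTwoGroupoid V
  ω : LinearMap.BilinForm ℝ (V _⦋2⦌)
  isSymplectic : IsSymplecticForm V (constForm ω)

/-- The level-`n` component of a simplicial linear map. -/
def level {V V' : SVect.{u}} (φ : V ⟶ V') (n : ℕ) : V _⦋n⦌ →ₗ[ℝ] V' _⦋n⦌ :=
  (φ.app (Opposite.op ⦋n⦌)).hom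

/-- Two constant symplectic 2-groupoids define the same class if, after an isomorphism of the
underlying linear 2-groupoids, their 2-forms are equivalent. -/
def ConstSympGpd.Equivalent (G G' : ConstSympGpd.{u}) : Prop :=
  ∃ φ : G.V ≅ G'.V,
    FormEquiv G.V (constForm G.ω) (pullback (level φ.hom 2) (constForm G'.ω))

/-! ### The linear algebra data -/

/-- The transpose `∂^* : W₀^* → W₁^* ≅ W₁` of `∂ : W₁ → W₀`, where `W₁` is identified with its dual
by means of a nondegenerate bilinear form. -/
def transposeVia {W₁ W₀ : Type*} [AddCommGroup W₁] [Module ℝ W₁] [FiniteDimensional ℝ W₁]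
    [AddCommGroup W₀] [Module ℝ W₀] (b : LinearMap.BilinForm ℝ W₁) (hb : b.Nondegenerate)
    (bd : W₁ →ₗ[ℝ] W₀) : Module.Dual ℝ W₀ →ₗ[ℝ] W₁ :=
  (b.toDual hb).symm.toLinearMap.comp bd.dualMap

/-- Tuples `(W₁, W₀, ⟨·,·⟩, ∂)`: finite-dimensional real vector spaces, a nondegenerate symmetric
bilinear form on `W₁`, and a linear map `∂ : W₁ → W₀` such that the image of `∂^*` is isotropic. -/
structure LinData : Type (u + 1) where
  W₁ : Type u
  W₀ : Type u
  [addCommGroup₁ : AddCommGroup W₁]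
  [module₁ : Module ℝ W₁]
  [finite₁ : FiniteDimensional ℝ W₁]
  [addCommGroup₀ : AddCommGroup W₀]
  [module₀ : Module ℝ W₀]
  [finite₀ : FiniteDimensional ℝ W₀]
  pairing : LinearMap.BilinForm ℝ W₁
  symm : pairing.IsSymm
  nondeg : pairing.Nondegenerate
  bd : W₁ →ₗ[ℝ] W₀
  isotropic : ∀ x ∈ LinearMap.range (transposeVia pairing nondeg bd),
    ∀ y ∈ LinearMap.range (transposeVia pairing nondeg bd), pairing x y = 0

attribute [instance] LinData.addCommGroup₁ LinData.module₁ LinData.finite₁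
  LinData.addCommGroup₀ LinData.module₀ LinData.finite₀

/-- Isomorphism of tuples. -/
def LinData.Isomorphic (T T' : LinData.{u}) : Prop :=
  ∃ (g₁ : T.W₁ ≃ₗ[ℝ] T'.W₁) (g₀ : T.W₀ ≃ₗ[ℝ] T'.W₀),
    (∀ w w', T'.pairing (g₁ w) (g₁ w') = T.pairing w w') ∧
    (∀ w, T'.bd (g₁ w) = g₀ (T.bd w))

/-- `W₁ = ker f_0 ⊆ V_1`. -/
abbrev kerFace (V : SVect.{u}) : Submodule ℝ (V _⦋1⦌) := LinearMap.ker (face V (n := 0) 0)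

/-- The tuple of a constant symplectic 2-groupoid `(V, ω)` is, up to isomorphism, `W₁ = ker f_0`,
`W₀ = V_0`, `⟨w, w'⟩ = B_ω(w, w')` and `∂ w = - f_1 w`. -/
def HasData (G : ConstSympGpd.{u}) (T : LinData.{u}) : Prop :=
  ∃ (e₁ : T.W₁ ≃ₗ[ℝ] kerFace G.V) (e₀ : T.W₀ ≃ₗ[ℝ] G.V _⦋0⦌),
    (∀ w w', T.pairing w w' =
      pairB G.V (constForm G.ω) 0 (e₁ w : G.V _⦋1⦌) (e₁ w' : G.V _⦋1⦌)) ∧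
    (∀ w, e₀ (T.bd w) = - face G.V (n := 0) 1 (e₁ w : G.V _⦋1⦌))

/-- The component `C₃₂(w, w') = ω((0,0,w,0), (0,w',0,0))` on `W₁ = ker f_0` of a constant 2-form
in the decomposition `V_2 = W₂ ⊕ W₁ ⊕ W₁ ⊕ W₀`, where `(0,0,w,0) = σ_1 w` and
`(0,w',0,0) = σ_0 w' - σ_1 w'`. -/
def C32 (V : SVect.{u}) (ω : LinearMap.BilinForm ℝ (V _⦋2⦌)) (w w' : kerFace V) : ℝ :=
  ω (degen V (n := 1) 1 (w : V _⦋1⦌))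
    (degen V (n := 1) 0 (w' : V _⦋1⦌) - degen V (n := 1) 1 (w' : V _⦋1⦌))

/-- The skew-symmetric part `r` of `C₃₂`. -/
def skewPart (V : SVect.{u}) (ω : LinearMap.BilinForm ℝ (V _⦋2⦌)) (w w' : kerFace V) : ℝ :=
  (C32 V ω w w' - C32 V ω w' w) / 2

/-! ### The two relations are equivalence relations -/

section Lemmas

variable {E F : Type*} [AddCommGroup E] [Module ℝ E] [AddCommGroup F] [Module ℝ F]

lemma SmoothFun.lineDifferentiableAt {g : E → ℝ} (hg : SmoothFun g) (x v : E) :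
    LineDifferentiableAt ℝ g x v := by
  let φ : (Fin 2 → ℝ) →ₗ[ℝ] E :=
    (LinearMap.proj 0 : (Fin 2 → ℝ) →ₗ[ℝ] ℝ).smulRight x
      + (LinearMap.proj 1 : (Fin 2 → ℝ) →ₗ[ℝ] ℝ).smulRight v
  have h := (hg 2 φ).differentiable (by simp)
  have h2 : Differentiable ℝ (fun t : ℝ => (![1, t] : Fin 2 → ℝ)) := by
    rw [differentiable_pi]
    intro i
    fin_cases i
    · simp
    · simp
  have h3 := (h.comp h2) 0
  simpa [LineDifferentiableAt, φ, Function.comp_def] using h3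

lemma IsTwoForm.pullback {α : F → LinearMap.BilinForm ℝ F} (h : IsTwoForm α) (f : E →ₗ[ℝ] F) :
    IsTwoForm (pullback f α) where
  alt x v := h.alt (f x) (f v)
  smooth v w n φ := h.smooth (f v) (f w) n (f.comp φ)

lemma ClosedForm.pullback {α : F → LinearMap.BilinForm ℝ F} (h : ClosedForm α) (f : E →ₗ[ℝ] F) :
    ClosedForm (pullback f α) := by
  intro x u v w
  have := h (f x) (f u) (f v) (f w)
  simpa [lineDeriv, ConstSymp.pullback, LinearMap.BilinForm.comp_apply] using this

lemma IsTwoForm.add {α β : E → LinearMap.BilinForm ℝ E} (h : IsTwoForm α) (h' : IsTwoForm β) :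
    IsTwoForm (fun x => α x + β x) where
  alt x v := by simp [h.alt x v, h'.alt x v]
  smooth v w n φ := (h.smooth v w n φ).add (h'.smooth v w n φ)

lemma IsTwoForm.neg {α : E → LinearMap.BilinForm ℝ E} (h : IsTwoForm α) :
    IsTwoForm (fun x => - α x) where
  alt x v := by simp [h.alt x v]
  smooth v w n φ := (h.smooth v w n φ).neg

lemma ClosedForm.neg {α : E → LinearMap.BilinForm ℝ E} (h : ClosedForm α) :
    ClosedForm (fun x => - α x) := by
  intro x u v w
  have := h x u v w
  simp only [lineDeriv, LinearMap.neg_apply, deriv.fun_neg] at this ⊢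
  linarith

lemma ClosedForm.add {α β : E → LinearMap.BilinForm ℝ E} (hα : IsTwoForm α) (hβ : IsTwoForm β)
    (h : ClosedForm α) (h' : ClosedForm β) : ClosedForm (fun x => α x + β x) := by
  intro x u v w
  have e : ∀ a b c : E, lineDeriv ℝ (fun y => (α y + β y) a b) x c
      = lineDeriv ℝ (fun y => α y a b) x c + lineDeriv ℝ (fun y => β y a b) x c := fun a b c =>
    deriv_fun_add ((hα.smooth a b).lineDifferentiableAt x c)
      ((hβ.smooth a b).lineDifferentiableAt x c)
  have h1 := h x u v w
  have h2 := h' x u v w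
  simp only [e]
  linarith

variable {V V' V'' : SVect.{u}}

lemma level_face (φ : V ⟶ V') {n : ℕ} (i : Fin (n + 2)) (x : V _⦋n + 1⦌) :
    face V' i (level φ (n + 1) x) = level φ n (face V i x) :=
  (LinearMap.congr_fun (congrArg ModuleCat.Hom.hom (SimplicialObject.δ_naturality φ i)) x).symm

lemma level_degen (φ : V ⟶ V') {n : ℕ} (i : Fin (n + 1)) (x : V _⦋n⦌) :
    degen V' i (level φ n x) = level φ (n + 1) (degen V i x) :=
  (LinearMap.congr_fun (congrArg ModuleCat.Hom.hom (SimplicialObject.σ_naturality φ i)) x).symm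

lemma cobdry_pullback (φ : V ⟶ V') {n : ℕ} (α : V' _⦋n⦌ → LinearMap.BilinForm ℝ (V' _⦋n⦌))
    (x : V _⦋n + 1⦌) :
    cobdry V (pullback (level φ n) α) x = pullback (level φ (n + 1)) (cobdry V' α) x := by
  ext v w
  simp [cobdry, pullback, LinearMap.BilinForm.comp_apply, level_face, LinearMap.sum_apply]

lemma cobdry_add {n : ℕ} (α β : V _⦋n⦌ → LinearMap.BilinForm ℝ (V _⦋n⦌)) (x : V _⦋n + 1⦌) :
    cobdry V (fun y => α y + β y) x = cobdry V α x + cobdry V β x := by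
  ext v w
  simp [cobdry, pullback, LinearMap.BilinForm.comp_apply, LinearMap.sum_apply, mul_add,
    Finset.sum_add_distrib]

lemma cobdry_neg {n : ℕ} (α : V _⦋n⦌ → LinearMap.BilinForm ℝ (V _⦋n⦌)) (x : V _⦋n + 1⦌) :
    cobdry V (fun y => - α y) x = - cobdry V α x := by
  ext v w
  simp [cobdry, pullback, LinearMap.BilinForm.comp_apply, LinearMap.sum_apply]

lemma level_unit2 (φ : V ⟶ V') (x : V _⦋0⦌) :
    unit2 V' (level φ 0 x) = level φ 2 (unit2 V x) := by
  simp [unit2, level_degen]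

lemma FormEquiv.refl (ω : V _⦋2⦌ → LinearMap.BilinForm ℝ (V _⦋2⦌)) : FormEquiv V ω ω := by
  refine ⟨fun _ => 0, ⟨fun x v => by simp, fun v w n φ => by simpa using contDiff_const⟩, ?_, ?_,
    ?_, ?_, ?_⟩
  · intro x u v w
    simp [lineDeriv]
  · intro i x
    ext v w
    simp [pullback, LinearMap.BilinForm.comp_apply]
  all_goals intros
  · ext v w
    simp [cobdry, pullback, LinearMap.BilinForm.comp_apply, LinearMap.sum_apply]
  · simp [pairA, cobdry, pullback, LinearMap.BilinForm.comp_apply, LinearMap.sum_apply]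
  · simp [pairB, cobdry, pullback, LinearMap.BilinForm.comp_apply, LinearMap.sum_apply]

lemma FormEquiv.symm {ω ω' : V _⦋2⦌ → LinearMap.BilinForm ℝ (V _⦋2⦌)} (h : FormEquiv V ω ω') :
    FormEquiv V ω' ω := by
  obtain ⟨α, h1, h2, h3, h4, h5, h6⟩ := h
  refine ⟨fun x => - α x, h1.neg, h2.neg, ?_, ?_, ?_, ?_⟩
  · intro i x
    have := h3 i x
    ext v w
    have := LinearMap.congr_fun (LinearMap.congr_fun this v) w
    simpa [pullback, LinearMap.BilinForm.comp_apply] using this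
  · intro x
    rw [cobdry_neg, ← h4 x]
    abel
  · intro x v w
    simpa [pairA, cobdry_neg] using h5 x v w
  · intro x v w
    have := h6 x v w
    simp only [pairB, cobdry_neg, LinearMap.neg_apply] at this ⊢
    linarith

lemma FormEquiv.trans {ω ω' ω'' : V _⦋2⦌ → LinearMap.BilinForm ℝ (V _⦋2⦌)}
    (h : FormEquiv V ω ω') (h' : FormEquiv V ω' ω'') : FormEquiv V ω ω'' := by
  obtain ⟨α, h1, h2, h3, h4, h5, h6⟩ := h
  obtain ⟨β, k1, k2, k3, k4, k5, k6⟩ := h'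
  refine ⟨fun x => α x + β x, h1.add k1, h2.add h1 k1 k2, ?_, ?_, ?_, ?_⟩
  · intro i x
    ext v w
    have e1 := LinearMap.congr_fun (LinearMap.congr_fun (h3 i x) v) w
    have e2 := LinearMap.congr_fun (LinearMap.congr_fun (k3 i x) v) w
    simp only [pullback, LinearMap.BilinForm.comp_apply, LinearMap.add_apply,
      LinearMap.zero_apply] at e1 e2 ⊢
    linarith
  · intro x
    rw [cobdry_add, ← h4 x, ← k4 x]
    abel
  · intro x v w
    have e1 := h5 x v w
    have e2 := k5 x v w
    simp only [pairA, cobdry_add, LinearMap.add_apply] at e1 e2 ⊢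
    linarith
  · intro x v w
    have e1 := h6 x v w
    have e2 := k6 x v w
    simp only [pairB, cobdry_add, LinearMap.add_apply] at e1 e2 ⊢
    linarith

lemma FormEquiv.pullback {ω ω' : V' _⦋2⦌ → LinearMap.BilinForm ℝ (V' _⦋2⦌)}
    (h : FormEquiv V' ω ω') (φ : V ⟶ V') :
    FormEquiv V (pullback (level φ 2) ω) (pullback (level φ 2) ω') := by
  obtain ⟨α, h1, h2, h3, h4, h5, h6⟩ := h
  refine ⟨ConstSymp.pullback (level φ 1) α, h1.pullback _, h2.pullback _, ?_, ?_, ?_, ?_⟩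
  · intro i x
    ext v w
    have e1 := LinearMap.congr_fun (LinearMap.congr_fun (h3 i (level φ 0 x)) (level φ 0 v))
      (level φ 0 w)
    simpa [ConstSymp.pullback, LinearMap.BilinForm.comp_apply, level_degen] using e1
  · intro x
    rw [cobdry_pullback]
    ext v w
    have e1 := LinearMap.congr_fun (LinearMap.congr_fun (h4 (level φ 2 x)) (level φ 2 v))
      (level φ 2 w)
    simpa [ConstSymp.pullback, LinearMap.BilinForm.comp_apply] using e1
  · intro x v w
    have e1 := h5 (level φ 0 x) (level φ 0 v) (level φ 2 w)
    simpa [pairA, cobdry_pullback, ConstSymp.pullback, LinearMap.BilinForm.comp_apply,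
      level_unit2] using e1
  · intro x v w
    have e1 := h6 (level φ 0 x) (level φ 1 v) (level φ 1 w)
    simpa [pairB, cobdry_pullback, ConstSymp.pullback, LinearMap.BilinForm.comp_apply,
      level_unit2, level_degen] using e1

lemma level_id (n : ℕ) (x : V _⦋n⦌) : level (𝟙 V) n x = x := rfl

lemma level_comp (φ : V ⟶ V') (ψ : V' ⟶ V'') (n : ℕ) (x : V _⦋n⦌) :
    level (φ ≫ ψ) n x = level ψ n (level φ n x) := rfl

end Lemmas

/-- Equivalence classes of constant symplectic 2-groupoids are the classes for this relation. -/
instance ConstSympGpd.setoid : Setoid ConstSympGpd.{u} where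
  r := ConstSympGpd.Equivalent
  iseqv :=
    { refl := fun G => ⟨Iso.refl _, FormEquiv.refl _⟩
      symm := by
        rintro G G' ⟨φ, h⟩
        refine ⟨φ.symm, ?_⟩
        have h2 := (h.pullback φ.inv).symm
        have e : pullback (level φ.inv 2) (pullback (level φ.hom 2) (constForm G'.ω))
            = constForm G'.ω := by
          funext x
          ext v w
          simp [pullback, constForm, LinearMap.BilinForm.comp_apply, ← level_comp, level_id]
        rw [e] at h2
        exact h2
      trans := by
        rintro G G' G'' ⟨φ, h⟩ ⟨ψ, h'⟩
        exact ⟨φ ≪≫ ψ, h.trans (h'.pullback φ.hom)⟩ }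

/-- Isomorphism classes of tuples. -/
instance LinData.setoid : Setoid LinData.{u} where
  r := LinData.Isomorphic
  iseqv :=
    { refl := fun T => ⟨LinearEquiv.refl _ _, LinearEquiv.refl _ _, by simp, by simp⟩
      symm := by
        rintro T T' ⟨g₁, g₀, h, h'⟩
        refine ⟨g₁.symm, g₀.symm, fun w w' => ?_, fun w => ?_⟩
        · rw [← h]; simp
        · rw [LinearEquiv.eq_symm_apply, ← h']; simp
      trans := by
        rintro T T' T'' ⟨g₁, g₀, h, h'⟩ ⟨k₁, k₀, k, k'⟩
        exact ⟨g₁.trans k₁, g₀.trans k₀, fun w w' => by simp [k, h], fun w => by simp [k', h']⟩ }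

end ConstSymp

end

/-! By the Dold–Kan correspondence a linear 2-groupoid is a complex `W₂ → W₁ → W₀` of vector spaces.
For a normalized cocycle `ω` the pairing `A_ω` between `W₀` and `W₂`, and the form `B_ω` on `W₁`,
make the two differentials adjoint to each other. Nondegeneracy therefore identifies `W₂` with
`W₀^*` and the first differential with `∂^*`, and isotropy of the image of `∂^*` says that
`∂ ∂^* = 0`.

The pairings determine the class of `ω`: if `A_ω = B_ω = 0`, then `γ(θ, η) = ω(σ₁θ, σ₀η)` is
alternating and `ω = -δγ`. Conversely, every pair of adjoint pairings comes from a normalized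
cocycle, given by an explicit cup-product formula. Within a class the cocycles differ by `δα` with
`α` an alternating form on `V₁ / σ₀(V₀)`, that is, on `ker f₀`; this is the torsor of the
forms `r`. -/

noncomputable section

namespace ConstSymp

section SimplicialIdentities

variable (V : SVect.{u}) {n : ℕ}

lemma face_face {a b : Fin (n + 2)} (h : a ≤ b) (x : V _⦋n + 2⦌) :
    face V a (face V b.succ x) = face V b (face V a.castSucc x) :=
  LinearMap.congr_fun (congrArg ModuleCat.Hom.hom (V.δ_comp_δ h)) x

lemma face_degen_self (i : Fin (n + 1)) (x : V _⦋n⦌) : face V i.castSucc (degen V i x) = x :=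
  LinearMap.congr_fun (congrArg ModuleCat.Hom.hom (V.δ_comp_σ_self (i := i))) x

lemma face_degen_succ (i : Fin (n + 1)) (x : V _⦋n⦌) : face V i.succ (degen V i x) = x :=
  LinearMap.congr_fun (congrArg ModuleCat.Hom.hom (V.δ_comp_σ_succ (i := i))) x

lemma face_degen_of_le {i : Fin (n + 2)} {j : Fin (n + 1)} (h : i ≤ j.castSucc)
    (x : V _⦋n + 1⦌) : face V i.castSucc (degen V j.succ x) = degen V j (face V i x) :=
  LinearMap.congr_fun (congrArg ModuleCat.Hom.hom (V.δ_comp_σ_of_le h)) x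

lemma face_degen_of_gt {i : Fin (n + 2)} {j : Fin (n + 1)} (h : j.castSucc < i)
    (x : V _⦋n + 1⦌) : face V i.succ (degen V j.castSucc x) = degen V j (face V i x) :=
  LinearMap.congr_fun (congrArg ModuleCat.Hom.hom (V.δ_comp_σ_of_gt h)) x

lemma degen_degen {i j : Fin (n + 1)} (h : i ≤ j) (x : V _⦋n⦌) :
    degen V i.castSucc (degen V j x) = degen V j.succ (degen V i x) :=
  LinearMap.congr_fun (congrArg ModuleCat.Hom.hom (V.σ_comp_σ h)) x

@[simp] lemma face_zero_degen_zero (x : V _⦋n⦌) : face V 0 (degen V 0 x) = x :=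
  face_degen_self V 0 x

@[simp] lemma face_one_degen_zero (x : V _⦋n⦌) : face V 1 (degen V 0 x) = x :=
  face_degen_succ V 0 x

@[simp] lemma face_two_degen_zero (x : V _⦋n + 1⦌) :
    face V 2 (degen V 0 x) = degen V 0 (face V 1 x) :=
  face_degen_of_gt V (i := 1) (j := 0) Fin.castSucc_lt_succ x

@[simp] lemma face_three_degen_zero (x : V _⦋n + 2⦌) :
    face V 3 (degen V 0 x) = degen V 0 (face V 2 x) :=
  face_degen_of_gt V (i := 2) (j := 0) (Fin.castSucc_lt_succ_iff.2 (Fin.zero_le 1)) x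

@[simp] lemma face_zero_degen_one (x : V _⦋n + 1⦌) :
    face V 0 (degen V 1 x) = degen V 0 (face V 0 x) :=
  face_degen_of_le V (i := 0) (j := 0) le_rfl x

@[simp] lemma face_one_degen_one (x : V _⦋n + 1⦌) : face V 1 (degen V 1 x) = x :=
  face_degen_self V 1 x

@[simp] lemma face_two_degen_one (x : V _⦋n + 1⦌) : face V 2 (degen V 1 x) = x :=
  face_degen_succ V 1 x

@[simp] lemma face_three_degen_one (x : V _⦋n + 2⦌) :
    face V 3 (degen V 1 x) = degen V 1 (face V 2 x) :=
  face_degen_of_gt V (i := 2) (j := 1) Fin.castSucc_lt_succ x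

@[simp] lemma face_zero_degen_two (x : V _⦋n + 2⦌) :
    face V 0 (degen V 2 x) = degen V 1 (face V 0 x) :=
  face_degen_of_le V (i := 0) (j := 1) (Fin.zero_le _) x

@[simp] lemma face_one_degen_two (x : V _⦋n + 2⦌) :
    face V 1 (degen V 2 x) = degen V 1 (face V 1 x) :=
  face_degen_of_le V (i := 1) (j := 1) le_rfl x

@[simp] lemma face_two_degen_two (x : V _⦋n + 2⦌) : face V 2 (degen V 2 x) = x :=
  face_degen_self V 2 x

@[simp] lemma face_three_degen_two (x : V _⦋n + 2⦌) : face V 3 (degen V 2 x) = x :=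
  face_degen_succ V 2 x

@[simp] lemma degen_one_degen_zero (x : V _⦋n⦌) :
    degen V 1 (degen V 0 x) = degen V 0 (degen V 0 x) :=
  (degen_degen V (i := 0) (j := 0) le_rfl x).symm

@[simp] lemma face_zero_face_one (x : V _⦋n + 2⦌) :
    face V 0 (face V 1 x) = face V 0 (face V 0 x) :=
  face_face V (a := 0) (b := 0) le_rfl x

@[simp] lemma face_zero_face_two (x : V _⦋n + 2⦌) :
    face V 0 (face V 2 x) = face V 1 (face V 0 x) :=
  face_face V (a := 0) (b := 1) (Fin.zero_le _) x

@[simp] lemma face_one_face_two (x : V _⦋n + 2⦌) :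
    face V 1 (face V 2 x) = face V 1 (face V 1 x) :=
  face_face V (a := 1) (b := 1) le_rfl x

@[simp] lemma face_zero_face_three (x : V _⦋n + 3⦌) :
    face V 0 (face V 3 x) = face V 2 (face V 0 x) :=
  face_face V (a := 0) (b := 2) (Fin.zero_le _) x

@[simp] lemma face_one_face_three (x : V _⦋n + 3⦌) :
    face V 1 (face V 3 x) = face V 2 (face V 1 x) :=
  face_face V (a := 1) (b := 2) (Fin.succ_le_succ_iff.2 (Fin.zero_le (1 : Fin (n + 2)))) x

@[simp] lemma face_two_face_three (x : V _⦋n + 3⦌) :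
    face V 2 (face V 3 x) = face V 2 (face V 2 x) :=
  face_face V (a := 2) (b := 2) le_rfl x

/-- The alternating sum `∑ (-1)^i f_i` of the faces. -/
def altFace (V : SVect.{u}) (n : ℕ) : V _⦋n + 1⦌ →ₗ[ℝ] V _⦋n⦌ :=
  ∑ i : Fin (n + 2), (-1 : ℤ) ^ (i : ℕ) • face V i

lemma altFace_zero (θ : V _⦋1⦌) : altFace V 0 θ = face V 0 θ - face V 1 θ := by
  simp [altFace, Fin.sum_univ_succ, sub_eq_add_neg]

lemma altFace_one (z : V _⦋2⦌) : altFace V 1 z = face V 0 z - face V 1 z + face V 2 z := by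
  simp [altFace, Fin.sum_univ_succ]
  abel

lemma altFace_two (x : V _⦋3⦌) :
    altFace V 2 x = face V 0 x - face V 1 x + face V 2 x - face V 3 x := by
  have h3 : (Fin.succ 2 : Fin 4) = 3 := rfl
  simp [altFace, Fin.sum_univ_succ, h3]
  abel

end SimplicialIdentities

section Horns

variable {V : SVect.{u}} {n : ℕ} {k : Fin (n + 3)}

lemma hornMap_mem_hornSpace (n : ℕ) (k : Fin (n + 2)) (x : V _⦋n + 1⦌) :
    hornMap V n k x ∈ hornSpace V n k := by
  cases n with
  | zero => trivial
  | succ n => exact fun _ _ hab _ _ => face_face V hab x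

lemma sub_mem_hornSpace {x y : {i : Fin (n + 3) // i ≠ k} → V _⦋n + 1⦌}
    (hx : x ∈ hornSpace V (n + 1) k) (hy : y ∈ hornSpace V (n + 1) k) :
    x - y ∈ hornSpace V (n + 1) k := fun a b hab ha hb => by
  simp only [Pi.sub_apply, map_sub, hx a b hab ha hb, hy a b hab ha hb]

lemma face_degen_horn_eq_zero {x : {i : Fin (n + 3) // i ≠ k} → V _⦋n + 1⦌}
    (hx : x ∈ hornSpace V (n + 1) k) {s : Fin (n + 2)} {i j : Fin (n + 3)} (hi : i ≠ k)
    (hj : j ≠ k) (hjs : j = s.castSucc ∨ j = s.succ) (h₀ : i ≠ s.castSucc) (h₁ : i ≠ s.succ)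
    (hxi : x ⟨i, hi⟩ = 0) : face V i (degen V s (x ⟨j, hj⟩)) = 0 := by
  rcases lt_or_gt_of_ne h₀ with h | h
  · obtain ⟨a, rfl⟩ := Fin.exists_castSucc_eq.2 (Fin.ne_last_of_lt h)
    have has : a < s := Fin.castSucc_lt_castSucc_iff.1 h
    obtain ⟨c, rfl⟩ := Fin.exists_succ_eq.2 (Fin.ne_zero_of_lt has)
    have hac : a ≤ c.castSucc := Fin.le_castSucc_iff.2 has
    have hface : face V a (x ⟨j, hj⟩) = 0 := by
      rcases hjs with rfl | rfl
      · exact (hx a c.castSucc hac hi hj).trans (by rw [hxi, map_zero])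
      · exact (hx a c.succ has.le hi hj).trans (by rw [hxi, map_zero])
    rw [face_degen_of_le V hac, hface, map_zero]
  · obtain ⟨b, rfl⟩ := Fin.exists_succ_eq.2 (Fin.ne_zero_of_lt h)
    have hsb : s < b := lt_of_le_of_ne (Fin.le_def.2 (Nat.lt_succ_iff.1 h)) fun e => h₁ (e ▸ rfl)
    obtain ⟨c, rfl⟩ := Fin.exists_castSucc_eq.2 (Fin.ne_last_of_lt hsb)
    have hface : face V b (x ⟨j, hj⟩) = 0 := by
      rcases hjs with rfl | rfl
      · exact (hx c.castSucc b hsb.le hj hi).symm.trans (by rw [hxi, map_zero])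
      · exact (hx c.succ b (Fin.castSucc_lt_iff_succ_le.1 hsb) hj hi).symm.trans
          (by rw [hxi, map_zero])
    rw [face_degen_of_gt V hsb, hface, map_zero]

lemma exists_prescribe_face {x : {i : Fin (n + 3) // i ≠ k} → V _⦋n + 1⦌}
    (hx : x ∈ hornSpace V (n + 1) k) (y : V _⦋n + 2⦌) {s : Fin (n + 2)} {j : Fin (n + 3)}
    (hj : j ≠ k) (hjs : j = s.castSucc ∨ j = s.succ) :
    ∃ z : V _⦋n + 2⦌, face V j z = x ⟨j, hj⟩ ∧ ∀ i (hi : i ≠ k), i ≠ s.castSucc → i ≠ s.succ →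
      face V i y = x ⟨i, hi⟩ → face V i z = x ⟨i, hi⟩ := by
  refine ⟨y + degen V s (x ⟨j, hj⟩ - face V j y), ?_, fun i hi h₀ h₁ hyi => ?_⟩
  · rcases hjs with rfl | rfl
    · rw [map_add, face_degen_self, add_sub_cancel]
    · rw [map_add, face_degen_succ, add_sub_cancel]
  · have hcorr : face V i (degen V s (x ⟨j, hj⟩ - face V j y)) = 0 :=
      face_degen_horn_eq_zero (sub_mem_hornSpace hx (hornMap_mem_hornSpace _ k y)) hi hj hjs
        h₀ h₁ (sub_eq_zero.2 hyi.symm)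
    rw [map_add, hcorr, add_zero, hyi]

lemma exists_face_eq_of_lt {x : {i : Fin (n + 3) // i ≠ k} → V _⦋n + 1⦌}
    (hx : x ∈ hornSpace V (n + 1) k) (r : ℕ) (hr : r ≤ k) :
    ∃ y : V _⦋n + 2⦌, ∀ i (hi : i ≠ k), (i : ℕ) < r → face V i y = x ⟨i, hi⟩ := by
  induction r with
  | zero => exact ⟨0, fun i _ hir => absurd hir (Nat.not_lt_zero _)⟩
  | succ r ih =>
    obtain ⟨y, hy⟩ := ih (by omega)
    let s : Fin (n + 2) := ⟨r, by omega⟩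
    obtain ⟨z, hzs, hz⟩ := exists_prescribe_face hx y (s := s) (Fin.ne_of_lt hr) (.inl rfl)
    refine ⟨z, fun i hi hir => ?_⟩
    rcases Nat.lt_succ_iff_lt_or_eq.1 hir with hir | hir
    · exact hz i hi (Fin.ne_of_lt hir) (Fin.ne_of_lt (Nat.lt_succ_of_lt hir)) (hy i hi hir)
    · obtain rfl : i = s.castSucc := Fin.ext hir
      exact hzs

lemma exists_face_eq_of_lt_or_gt {x : {i : Fin (n + 3) // i ≠ k} → V _⦋n + 1⦌}
    (hx : x ∈ hornSpace V (n + 1) k) (r : ℕ) (hr : r + k ≤ n + 2) :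
    ∃ y : V _⦋n + 2⦌, ∀ i (hi : i ≠ k), i < k ∨ n + 2 < i + r → face V i y = x ⟨i, hi⟩ := by
  induction r with
  | zero =>
    obtain ⟨y, hy⟩ := exists_face_eq_of_lt hx k le_rfl
    exact ⟨y, fun i hi h => hy i hi (h.resolve_right (by omega))⟩
  | succ r ih =>
    obtain ⟨y, hy⟩ := ih (by omega)
    let s : Fin (n + 2) := ⟨n + 1 - r, by omega⟩
    have hsv : (s : ℕ) = n + 1 - r := rfl
    have hs : s.succ ≠ k := by rw [ne_eq, Fin.ext_iff, Fin.val_succ]; omega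
    obtain ⟨z, hzs, hz⟩ := exists_prescribe_face hx y hs (.inr rfl)
    refine ⟨z, fun i hi h => ?_⟩
    by_cases his : i = s.succ
    · subst his
      exact hzs
    · rw [Fin.ext_iff, Fin.val_succ] at his
      refine hz i hi ?_ (mt Fin.ext_iff.1 his) (hy i hi (h.imp_right (by omega)))
      rintro rfl
      rw [Fin.lt_def, Fin.val_castSucc] at h
      rw [ne_eq, Fin.ext_iff, Fin.val_castSucc] at hi
      omega

lemma surjOn_hornMap (V : SVect.{u}) (n : ℕ) (k : Fin (n + 2)) :
    Set.SurjOn (hornMap V n k) Set.univ (hornSpace V n k) := by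
  intro x hx
  cases n with
  | zero =>
    have hk : k.rev ≠ k := (by decide : ∀ k : Fin 2, k.rev ≠ k) k
    refine ⟨degen V 0 (x ⟨k.rev, hk⟩), trivial, funext fun ⟨i, hi⟩ => ?_⟩
    obtain rfl : i = k.rev := (by decide : ∀ i k : Fin 2, i ≠ k → i = k.rev) i k hi
    generalize x ⟨k.rev, hi⟩ = z
    change face V k.rev (degen V 0 z) = z
    fin_cases k
    exacts [face_degen_succ V 0 z, face_degen_self V 0 z]
  | succ n =>
    obtain ⟨y, hy⟩ := exists_face_eq_of_lt_or_gt hx (n + 2 - k) (by omega)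
    refine ⟨y, trivial, funext fun ⟨i, hi⟩ => hy i hi ?_⟩
    have hik : (i : ℕ) ≠ k := mt Fin.ext hi
    rw [Fin.lt_def]
    omega

lemma eq_zero_of_face_eq_zero
    (h : ∀ y : V _⦋n + 2⦌, (∀ i : Fin (n + 2), face V i.succ y = 0) → y = 0) (k : Fin (n + 3)) :
    ∀ y : V _⦋n + 2⦌, (∀ i, i ≠ k → face V i y = 0) → y = 0 := by
  induction k using Fin.induction with
  | zero => exact fun y hy => h y fun i => hy _ (Fin.succ_ne_zero i)
  | succ s ih =>
    intro y hy
    -- Only the `s`-th face of `y - σ_s f_{s+1} y` can be nonzero, which reduces `s + 1` to `s`.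
    have hy_eq : y - degen V s (face V s.succ y) = 0 := by
      refine ih _ fun i hi => ?_
      by_cases his : i = s.succ
      · rw [his, map_sub, face_degen_succ, sub_self]
      · have hcorr := face_degen_horn_eq_zero (hornMap_mem_hornSpace (n + 1) s.castSucc y) hi
          (Fin.castSucc_lt_succ.ne') (.inr rfl) hi his (hy i his)
        rw [map_sub, hy i his, zero_sub, neg_eq_zero]
        exact hcorr
    have hface : face V s.succ y = 0 := by
      have hf := congrArg (face V s.castSucc) hy_eq
      rwa [map_sub, face_degen_self, hy _ Fin.castSucc_lt_succ.ne, zero_sub, map_zero,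
        neg_eq_zero] at hf
    simpa only [hface, map_zero, sub_zero] using hy_eq

end Horns

section ConstantForms

lemma isTwoForm_constForm {E : Type*} [AddCommGroup E] [Module ℝ E]
    {ω : LinearMap.BilinForm ℝ E} (h : ω.IsAlt) : IsTwoForm (constForm ω) where
  alt _ := h
  smooth v w _ _ := contDiff_const (c := ω v w)

lemma closedForm_constForm {E : Type*} [AddCommGroup E] [Module ℝ E]
    (ω : LinearMap.BilinForm ℝ E) : ClosedForm (constForm ω) := by
  intro x u v w
  simp [constForm, lineDeriv]

variable {V : SVect.{u}}

/-- The simplicial coboundary of a constant 2-form, as a constant 2-form. -/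
def constCobdry {n : ℕ} (γ : LinearMap.BilinForm ℝ (V _⦋n⦌)) :
    LinearMap.BilinForm ℝ (V _⦋n + 1⦌) :=
  cobdry V (constForm γ) 0

lemma constCobdry_apply {n : ℕ} (γ : LinearMap.BilinForm ℝ (V _⦋n⦌)) (x y : V _⦋n + 1⦌) :
    constCobdry γ x y =
      ∑ i : Fin (n + 2), (-1 : ℝ) ^ (i : ℕ) * γ (face V i x) (face V i y) := by
  simp only [constCobdry, cobdry, LinearMap.sum_apply, LinearMap.smul_apply, smul_eq_mul, pullback,
    constForm, LinearMap.BilinForm.comp_apply]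

lemma constCobdry_one_apply (γ : LinearMap.BilinForm ℝ (V _⦋1⦌)) (x y : V _⦋2⦌) :
    constCobdry γ x y =
      γ (face V 0 x) (face V 0 y) - γ (face V 1 x) (face V 1 y) + γ (face V 2 x) (face V 2 y) := by
  rw [constCobdry_apply, Fin.sum_univ_three]
  norm_num [sub_eq_add_neg]

lemma constCobdry_two_apply (ω : LinearMap.BilinForm ℝ (V _⦋2⦌)) (x y : V _⦋3⦌) :
    constCobdry ω x y =
      ω (face V 0 x) (face V 0 y) - ω (face V 1 x) (face V 1 y)
        + ω (face V 2 x) (face V 2 y) - ω (face V 3 x) (face V 3 y) := by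
  rw [constCobdry_apply, Fin.sum_univ_four]
  norm_num [sub_eq_add_neg]

lemma constCobdry_constCobdry (γ : LinearMap.BilinForm ℝ (V _⦋1⦌)) :
    constCobdry (constCobdry γ) = 0 := by
  ext x y
  simp only [constCobdry_two_apply, constCobdry_one_apply, face_zero_face_one, face_zero_face_two,
    face_one_face_two, face_zero_face_three, face_one_face_three, face_two_face_three,
    LinearMap.zero_apply]
  ring

/-- The pairing `A_ω` of a constant 2-form `ω`, as a bilinear map. -/
def formA (ω : LinearMap.BilinForm ℝ (V _⦋2⦌)) : V _⦋0⦌ →ₗ[ℝ] V _⦋2⦌ →ₗ[ℝ] ℝ :=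
  ω ∘ₗ unit2 V

/-- The bilinear form `γ(θ, η) = ω(σ₁θ, σ₀η)` on `V₁`, whose symmetrization is `B_ω`. -/
def crossForm (ω : LinearMap.BilinForm ℝ (V _⦋2⦌)) : LinearMap.BilinForm ℝ (V _⦋1⦌) :=
  ω.compl₁₂ (degen V 1) (degen V 0)

/-- The pairing `B_ω` of a constant 2-form `ω`, as a bilinear form. -/
def formB (ω : LinearMap.BilinForm ℝ (V _⦋2⦌)) : LinearMap.BilinForm ℝ (V _⦋1⦌) :=
  crossForm ω + (crossForm ω).flip

lemma formA_apply (ω : LinearMap.BilinForm ℝ (V _⦋2⦌)) (v : V _⦋0⦌) (w : V _⦋2⦌) :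
    formA ω v w = ω (degen V 0 (degen V 0 v)) w := rfl

lemma crossForm_apply (ω : LinearMap.BilinForm ℝ (V _⦋2⦌)) (θ η : V _⦋1⦌) :
    crossForm ω θ η = ω (degen V 1 θ) (degen V 0 η) := rfl

lemma formB_apply (ω : LinearMap.BilinForm ℝ (V _⦋2⦌)) (θ η : V _⦋1⦌) :
    formB ω θ η = crossForm ω θ η + crossForm ω η θ := rfl

lemma crossForm_add (ω ω' : LinearMap.BilinForm ℝ (V _⦋2⦌)) :
    crossForm (ω + ω') = crossForm ω + crossForm ω' := rfl

lemma crossForm_sub (ω ω' : LinearMap.BilinForm ℝ (V _⦋2⦌)) :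
    crossForm (ω' - ω) = crossForm ω' - crossForm ω := rfl

lemma formB_sub (ω ω' : LinearMap.BilinForm ℝ (V _⦋2⦌)) :
    formB (ω' - ω) = formB ω' - formB ω := by
  ext θ η
  simp only [formB_apply, crossForm_sub, LinearMap.sub_apply]
  ring

lemma pairB_constForm (ω : LinearMap.BilinForm ℝ (V _⦋2⦌)) (x : V _⦋0⦌) (θ η : V _⦋1⦌) :
    pairB V (constForm ω) x θ η = formB ω θ η := rfl

/-- The projection of `V₁` onto `ker f₀` along the degenerate subspace. -/
def projKerFace (V : SVect.{u}) : V _⦋1⦌ →ₗ[ℝ] kerFace V :=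
  (LinearMap.id - degen V 0 ∘ₗ face V 0).codRestrict _ fun θ => by simp

lemma coe_projKerFace (θ : V _⦋1⦌) :
    (projKerFace V θ : V _⦋1⦌) = θ - degen V 0 (face V 0 θ) := rfl

@[simp] lemma projKerFace_coe (w : kerFace V) : projKerFace V (w : V _⦋1⦌) = w := by
  ext
  rw [coe_projKerFace, LinearMap.mem_ker.1 w.2, map_zero, sub_zero]

@[simp] lemma projKerFace_degen (v : V _⦋0⦌) : projKerFace V (degen V 0 v) = 0 := by
  ext
  simp [coe_projKerFace]

/-- The skew-symmetric part of the restriction of `crossForm ω` to `ker f₀`; for a normalized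
cocycle `ω` it is the form `r`. -/
def skewForm (ω : LinearMap.BilinForm ℝ (V _⦋2⦌)) : LinearMap.BilinForm ℝ (kerFace V) :=
  (2⁻¹ : ℝ) • (crossForm ω - (crossForm ω).flip).restrict (kerFace V)

lemma skewForm_apply (ω : LinearMap.BilinForm ℝ (V _⦋2⦌)) (w w' : kerFace V) :
    skewForm ω w w' = (crossForm ω w w' - crossForm ω w' w) / 2 :=
  inv_mul_eq_div _ _

lemma isAlt_skewForm (ω : LinearMap.BilinForm ℝ (V _⦋2⦌)) : (skewForm ω).IsAlt := fun w => by
  rw [skewForm_apply, sub_self, zero_div]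

lemma crossForm_eq_formB_add_skewForm (ω : LinearMap.BilinForm ℝ (V _⦋2⦌)) (w w' : kerFace V) :
    crossForm ω w w' = formB ω w w' / 2 + skewForm ω w w' := by
  rw [formB_apply, skewForm_apply]
  ring

end ConstantForms

section Cocycles

variable {V : SVect.{u}}

variable (V) in
/-- Constant 2-forms on `V₂` that are alternating, multiplicative and normalized: the conditions on
a constant symplectic form other than nondegeneracy. -/
structure IsNormalizedCocycle (ω : LinearMap.BilinForm ℝ (V _⦋2⦌)) : Prop where
  alt : ω.IsAlt
  mult : constCobdry ω = 0
  norm_zero : ∀ θ η, ω (degen V 0 θ) (degen V 0 η) = 0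
  norm_one : ∀ θ η, ω (degen V 1 θ) (degen V 1 η) = 0

lemma isSymplecticForm_constForm_iff {ω : LinearMap.BilinForm ℝ (V _⦋2⦌)} :
    IsSymplecticForm V (constForm ω) ↔
      IsNormalizedCocycle V ω ∧ SimpliciallyNondegenerate V (constForm ω) where
  mp h := by
    refine ⟨⟨h.form.alt 0, h.mult 0, fun θ η => ?_, fun θ η => ?_⟩, h.nondeg⟩
    exacts [LinearMap.congr_fun₂ (h.normalized 0 0) θ η,
      LinearMap.congr_fun₂ (h.normalized 1 0) θ η]
  mpr h := by
    refine ⟨isTwoForm_constForm h.1.alt, closedForm_constForm ω, fun _ => h.1.mult, fun i _ => ?_,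
      h.2⟩
    ext θ η
    fin_cases i
    exacts [h.1.norm_zero θ η, h.1.norm_one θ η]

namespace IsNormalizedCocycle

variable {ω ω' : LinearMap.BilinForm ℝ (V _⦋2⦌)}

lemma mult_apply (h : IsNormalizedCocycle V ω) (x y : V _⦋3⦌) :
    ω (face V 0 x) (face V 0 y) - ω (face V 1 x) (face V 1 y) + ω (face V 2 x) (face V 2 y)
      - ω (face V 3 x) (face V 3 y) = 0 := by
  rw [← constCobdry_two_apply, h.mult, LinearMap.zero_apply, LinearMap.zero_apply]

lemma add (h : IsNormalizedCocycle V ω) (h' : IsNormalizedCocycle V ω') :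
    IsNormalizedCocycle V (ω + ω') where
  alt := h.alt.add h'.alt
  mult := by
    ext x y
    simp only [constCobdry_two_apply, LinearMap.add_apply, LinearMap.zero_apply]
    linear_combination h.mult_apply x y + h'.mult_apply x y
  norm_zero θ η := by simp [h.norm_zero, h'.norm_zero]
  norm_one θ η := by simp [h.norm_one, h'.norm_one]

lemma sub (h : IsNormalizedCocycle V ω) (h' : IsNormalizedCocycle V ω') :
    IsNormalizedCocycle V (ω - ω') where
  alt := h.alt.sub h'.alt
  mult := by
    ext x y
    simp only [constCobdry_two_apply, LinearMap.sub_apply, LinearMap.zero_apply]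
    linear_combination h.mult_apply x y - h'.mult_apply x y
  norm_zero θ η := by simp [h.norm_zero, h'.norm_zero]
  norm_one θ η := by simp [h.norm_one, h'.norm_one]

lemma comp_level {V' : SVect.{u}} {ω : LinearMap.BilinForm ℝ (V' _⦋2⦌)}
    (h : IsNormalizedCocycle V' ω) (φ : V ⟶ V') :
    IsNormalizedCocycle V (ω.comp (level φ 2) (level φ 2)) where
  alt x := h.alt _
  mult := by
    ext x y
    simpa only [constCobdry_two_apply, level_face, LinearMap.BilinForm.comp_apply,
      LinearMap.zero_apply] using h.mult_apply (level φ 3 x) (level φ 3 y)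
  norm_zero θ η := by
    rw [LinearMap.BilinForm.comp_apply, ← level_degen, ← level_degen, h.norm_zero]
  norm_one θ η := by
    rw [LinearMap.BilinForm.comp_apply, ← level_degen, ← level_degen, h.norm_one]

variable (h : IsNormalizedCocycle V ω)
include h

lemma mult_zero_one (x y : V _⦋2⦌) :
    ω x (degen V 0 (face V 0 y)) - ω x y + ω (degen V 0 (face V 1 x)) y
      - ω (degen V 0 (face V 2 x)) (degen V 1 (face V 2 y)) = 0 := by
  simpa using h.mult_apply (degen V 0 x) (degen V 1 y)

lemma mult_zero_two (x y : V _⦋2⦌) :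
    ω x (degen V 1 (face V 0 y)) - ω x (degen V 1 (face V 1 y)) + ω (degen V 0 (face V 1 x)) y
      - ω (degen V 0 (face V 2 x)) y = 0 := by
  simpa using h.mult_apply (degen V 0 x) (degen V 2 y)

lemma mult_one_two (x y : V _⦋2⦌) :
    ω (degen V 0 (face V 0 x)) (degen V 1 (face V 0 y)) - ω x (degen V 1 (face V 1 y)) + ω x y
      - ω (degen V 1 (face V 2 x)) y = 0 := by
  simpa using h.mult_apply (degen V 1 x) (degen V 2 y)

lemma apply_swap (x y : V _⦋2⦌) : ω x y = -ω y x := (h.alt.neg_eq y x).symm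

lemma formA_degen (i : Fin 2) (v : V _⦋0⦌) (θ : V _⦋1⦌) : formA ω v (degen V i θ) = 0 := by
  rw [formA_apply]
  fin_cases i
  · exact h.norm_zero _ _
  · rw [← degen_one_degen_zero]
    exact h.norm_one _ _

lemma crossForm_degen_left (v : V _⦋0⦌) (θ : V _⦋1⦌) : crossForm ω (degen V 0 v) θ = 0 := by
  rw [crossForm_apply, degen_one_degen_zero, h.norm_zero]

lemma crossForm_degen_right (v : V _⦋0⦌) (θ : V _⦋1⦌) : crossForm ω θ (degen V 0 v) = 0 := by
  rw [crossForm_apply, ← degen_one_degen_zero, h.norm_one]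

lemma crossForm_eq_projKerFace (θ η : V _⦋1⦌) :
    crossForm ω θ η = crossForm ω (projKerFace V θ) (projKerFace V η) := by
  simp only [coe_projKerFace, map_sub, LinearMap.sub_apply, h.crossForm_degen_left,
    h.crossForm_degen_right, sub_zero]

lemma formB_degen (v : V _⦋0⦌) (θ : V _⦋1⦌) : formB ω (degen V 0 v) θ = 0 := by
  rw [formB_apply, h.crossForm_degen_left, h.crossForm_degen_right, add_zero]

lemma formB_altFace (θ : V _⦋1⦌) (z : V _⦋2⦌) :
    formB ω θ (altFace V 1 z) = formA ω (altFace V 0 θ) z := by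
  rw [altFace_one, altFace_zero]
  have h₀₁ := h.mult_zero_one z (degen V 1 θ)
  have h₁₂ := h.mult_one_two z (degen V 0 θ)
  have h₀₂ := h.mult_zero_two (degen V 0 θ) z
  simp only [face_zero_degen_one, face_two_degen_one] at h₀₁
  simp only [face_zero_degen_zero, face_one_degen_zero] at h₁₂
  simp only [face_one_degen_zero, face_two_degen_zero] at h₀₂
  have swap_unit := h.apply_swap z (degen V 0 (degen V 0 (face V 0 θ)))
  have swap_degen := h.apply_swap z (degen V 0 θ)
  have swap_one_zero := fun η => h.apply_swap (degen V 1 θ) (degen V 0 η)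
  have swap_zero_one := fun η => h.apply_swap (degen V 1 η) (degen V 0 θ)
  simp only [swap_unit, swap_degen] at h₀₁ h₁₂
  simp only [formA_apply, formB_apply, crossForm_apply, map_sub, map_add, LinearMap.sub_apply,
    swap_one_zero, swap_zero_one]
  linarith [swap_zero_one (face V 2 z)]

end IsNormalizedCocycle

section Coboundaries

variable {γ : LinearMap.BilinForm ℝ (V _⦋1⦌)} (hγ : γ.IsAlt)
  (hγ_degen : ∀ v θ, γ (degen V 0 v) θ = 0)

include hγ_degen in
lemma formA_constCobdry : formA (constCobdry γ) = 0 := by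
  ext v w
  simp [formA_apply, constCobdry_one_apply, hγ_degen]

include hγ hγ_degen

lemma isNormalizedCocycle_constCobdry : IsNormalizedCocycle V (constCobdry γ) where
  alt x := by simp [constCobdry_one_apply, hγ _]
  mult := constCobdry_constCobdry γ
  norm_zero θ η := by simp [constCobdry_one_apply, hγ_degen]
  norm_one θ η := by simp [constCobdry_one_apply, hγ_degen]

lemma crossForm_constCobdry : crossForm (constCobdry γ) = -γ := by
  ext θ η
  have hγ_degen' : γ θ (degen V 0 (face V 1 η)) = 0 := by rw [← hγ.neg_eq, hγ_degen, neg_zero]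
  simp [crossForm_apply, constCobdry_one_apply, hγ_degen, hγ_degen']

lemma formB_constCobdry : formB (constCobdry γ) = 0 := by
  ext θ η
  simp [formB_apply, crossForm_constCobdry hγ hγ_degen, ← hγ.neg_eq θ η]

lemma formEquiv_add_constCobdry (ω : LinearMap.BilinForm ℝ (V _⦋2⦌)) :
    FormEquiv V (constForm ω) (constForm (ω + constCobdry γ)) := by
  refine ⟨constForm γ, isTwoForm_constForm hγ, closedForm_constForm γ, fun i x => ?_,
    fun _ => add_sub_cancel_left ω (constCobdry γ), fun _ v w => ?_, fun _ θ η => ?_⟩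
  · ext v θ
    obtain rfl := Fin.eq_zero i
    exact hγ_degen v _
  · exact LinearMap.congr_fun₂ (formA_constCobdry hγ_degen) v w
  · exact LinearMap.congr_fun₂ (formB_constCobdry hγ hγ_degen) θ η

end Coboundaries

section Classification

lemma FormEquiv.pairA_eq {ω ω' : V _⦋2⦌ → LinearMap.BilinForm ℝ (V _⦋2⦌)} (h : FormEquiv V ω ω')
    (x v : V _⦋0⦌) (w : V _⦋2⦌) : pairA V ω' x v w = pairA V ω x v w := by
  obtain ⟨α, -, -, -, hα, hA, -⟩ := h
  simpa only [pairA, ← hα, LinearMap.sub_apply, sub_eq_zero] using hA x v w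

lemma FormEquiv.pairB_eq {ω ω' : V _⦋2⦌ → LinearMap.BilinForm ℝ (V _⦋2⦌)} (h : FormEquiv V ω ω')
    (x : V _⦋0⦌) (θ η : V _⦋1⦌) : pairB V ω' x θ η = pairB V ω x θ η := by
  obtain ⟨α, -, -, -, hα, -, hB⟩ := h
  have := hB x θ η
  simp only [pairB, ← hα, LinearMap.sub_apply] at this ⊢
  linarith

lemma SimpliciallyNondegenerate.of_formEquiv {ω ω' : V _⦋2⦌ → LinearMap.BilinForm ℝ (V _⦋2⦌)}
    (hω : SimpliciallyNondegenerate V ω) (h : FormEquiv V ω ω') :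
    SimpliciallyNondegenerate V ω' where
  left_A x v := by simpa only [h.pairA_eq] using hω.left_A x v
  right_A x w := by simpa only [h.pairA_eq] using hω.right_A x w
  nondeg_B x θ := by simpa only [h.pairB_eq] using hω.nondeg_B x θ

namespace IsNormalizedCocycle

variable {ω ω' : LinearMap.BilinForm ℝ (V _⦋2⦌)}

lemma eq_constCobdry (h : IsNormalizedCocycle V ω) (hA : formA ω = 0) (hB : formB ω = 0) :
    ω = constCobdry (-crossForm ω) := by
  have cross_swap : ∀ θ η, crossForm ω θ η = -crossForm ω η θ := fun θ η =>
    eq_neg_of_add_eq_zero_left (LinearMap.congr_fun₂ hB θ η)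
  have apply_degen_one : ∀ x θ,
      ω x (degen V 1 θ) = crossForm ω (face V 1 x) θ - crossForm ω (face V 2 x) θ := fun x θ => by
    have hunit : ω x (degen V 0 (degen V 0 (face V 0 θ))) = 0 := by
      rw [h.apply_swap, ← formA_apply, hA, LinearMap.zero_apply, LinearMap.zero_apply, neg_zero]
    have h₀₂ := h.mult_zero_two x (degen V 1 θ)
    simp only [face_zero_degen_one, face_one_degen_one, degen_one_degen_zero, hunit] at h₀₂
    rw [h.apply_swap (degen V 0 _), h.apply_swap (degen V 0 _), ← crossForm_apply,
      ← crossForm_apply, cross_swap θ, cross_swap θ] at h₀₂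
    linarith
  ext x y
  have h₁₂ := h.mult_one_two x y
  rw [h.apply_swap (degen V 0 (face V 0 x)), ← crossForm_apply, apply_degen_one,
    h.apply_swap (degen V 1 (face V 2 x)), apply_degen_one, cross_swap (face V 0 y),
    cross_swap (face V 1 y), cross_swap (face V 2 y)] at h₁₂
  simp only [constCobdry_one_apply, LinearMap.neg_apply]
  linarith

lemma formEquiv (h : IsNormalizedCocycle V ω) (h' : IsNormalizedCocycle V ω')
    (hA : formA ω' = formA ω) (hB : formB ω' = formB ω) :
    FormEquiv V (constForm ω) (constForm ω') := by
  have hd := h'.sub h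
  have hA' : formA (ω' - ω) = 0 := sub_eq_zero.2 hA
  have hB' : formB (ω' - ω) = 0 := (formB_sub ω ω').trans (sub_eq_zero.2 hB)
  have hsub := hd.eq_constCobdry hA' hB'
  rw [← add_sub_cancel ω ω', hsub]
  refine formEquiv_add_constCobdry (fun θ => ?_) (fun v θ => ?_) ω
  · have hθ : formB (ω' - ω) θ θ = 0 := LinearMap.congr_fun₂ hB' θ θ
    rw [formB_apply] at hθ
    rw [LinearMap.neg_apply, LinearMap.neg_apply]
    linarith
  · rw [LinearMap.neg_apply, LinearMap.neg_apply, hd.crossForm_degen_left, neg_zero]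

lemma formEquiv_iff (h : IsNormalizedCocycle V ω) (h' : IsNormalizedCocycle V ω') :
    FormEquiv V (constForm ω) (constForm ω') ↔
      (∀ v w, pairA V (constForm ω') 0 v w = pairA V (constForm ω) 0 v w) ∧
      (∀ θ η, pairB V (constForm ω') 0 θ η = pairB V (constForm ω) 0 θ η) :=
  ⟨fun e => ⟨e.pairA_eq 0, e.pairB_eq 0⟩,
    fun e => h.formEquiv h' (LinearMap.ext₂ e.1) (LinearMap.ext₂ e.2)⟩

lemma skewPart_eq (h : IsNormalizedCocycle V ω) (w w' : kerFace V) :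
    skewPart V ω w w' = skewForm ω w w' := by
  simp only [skewPart, C32, map_sub, h.norm_one, sub_zero, skewForm_apply, crossForm_apply]

lemma eq_of_skewForm_eq (h : IsNormalizedCocycle V ω) (h' : IsNormalizedCocycle V ω')
    (e : FormEquiv V (constForm ω) (constForm ω')) (hr : skewForm ω = skewForm ω') : ω = ω' := by
  have hA : formA ω' = formA ω := LinearMap.ext₂ (e.pairA_eq 0)
  have hB : formB ω' = formB ω := LinearMap.ext₂ (e.pairB_eq 0)
  have hcross : crossForm ω' = crossForm ω := LinearMap.ext₂ fun θ η => by
    rw [h'.crossForm_eq_projKerFace, h.crossForm_eq_projKerFace, crossForm_eq_formB_add_skewForm,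
      crossForm_eq_formB_add_skewForm, hB, hr]
  have hd := (h'.sub h).eq_constCobdry (sub_eq_zero.2 hA)
    ((formB_sub ω ω').trans (sub_eq_zero.2 hB))
  rw [(crossForm_sub ω ω').trans (sub_eq_zero.2 hcross)] at hd
  exact (sub_eq_zero.1 (hd.trans (LinearMap.ext₂ fun x y => by simp [constCobdry_one_apply]))).symm

lemma exists_formEquiv_skewForm_eq (h : IsNormalizedCocycle V ω)
    {r : LinearMap.BilinForm ℝ (kerFace V)} (hr : r.IsAlt) :
    ∃ ω', IsNormalizedCocycle V ω' ∧ FormEquiv V (constForm ω) (constForm ω') ∧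
      skewForm ω' = r := by
  let γ : LinearMap.BilinForm ℝ (V _⦋1⦌) :=
    (skewForm ω - r).compl₁₂ (projKerFace V) (projKerFace V)
  have hγ : γ.IsAlt := fun θ => ((isAlt_skewForm ω).sub hr) _
  have hγ_degen : ∀ v θ, γ (degen V 0 v) θ = 0 := fun v θ => by
    rw [LinearMap.compl₁₂_apply, projKerFace_degen, map_zero, LinearMap.zero_apply]
  refine ⟨ω + constCobdry γ, h.add (isNormalizedCocycle_constCobdry hγ hγ_degen),
    formEquiv_add_constCobdry hγ hγ_degen ω, LinearMap.ext₂ fun w w' => ?_⟩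
  have hcross : ∀ w w' : kerFace V, crossForm (ω + constCobdry γ) w w' =
      crossForm ω w w' - (skewForm ω w w' - r w w') := fun w w' => by
    rw [crossForm_add, crossForm_constCobdry hγ hγ_degen]
    simp [γ, sub_eq_add_neg]
  rw [skewForm_apply, hcross, hcross, ← (isAlt_skewForm ω).neg_eq w w', ← hr.neg_eq w w',
    skewForm_apply]
  ring

end IsNormalizedCocycle

lemma existsUnique_skewPart_eq {ω : LinearMap.BilinForm ℝ (V _⦋2⦌)}
    (h : IsSymplecticForm V (constForm ω)) {r : LinearMap.BilinForm ℝ (kerFace V)}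
    (hr : r.IsAlt) :
    ∃! ω' : LinearMap.BilinForm ℝ (V _⦋2⦌), IsSymplecticForm V (constForm ω') ∧
      FormEquiv V (constForm ω) (constForm ω') ∧ ∀ w w', skewPart V ω' w w' = r w w' := by
  obtain ⟨hω, hnd⟩ := isSymplecticForm_constForm_iff.1 h
  obtain ⟨ω', hω', hequiv, rfl⟩ := hω.exists_formEquiv_skewForm_eq hr
  refine ⟨ω', ⟨isSymplecticForm_constForm_iff.2 ⟨hω', hnd.of_formEquiv hequiv⟩, hequiv,
    hω'.skewPart_eq⟩, ?_⟩
  rintro ω'' ⟨hsymp, hequiv', hskew⟩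
  have hω'' := (isSymplecticForm_constForm_iff.1 hsymp).1
  exact hω''.eq_of_skewForm_eq hω' (hequiv'.symm.trans hequiv)
    (LinearMap.ext₂ fun w w' => by rw [← hω''.skewPart_eq, hskew])

end Classification

end Cocycles

section DoldKan

open AlgebraicTopology

/-- The normalized subspace of `V_n`: the common kernel of the faces `f_1, …, f_n`. -/
def normPart (V : SVect.{u}) (n : ℕ) : Submodule ℝ (V _⦋n⦌) :=
  match n with
  | 0 => ⊤
  | n + 1 => ⨅ i : Fin (n + 1), LinearMap.ker (face V i.succ)

variable {V V' : SVect.{u}} {n : ℕ}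

lemma mem_normPart_succ {x : V _⦋n + 1⦌} :
    x ∈ normPart V (n + 1) ↔ ∀ i : Fin (n + 1), face V i.succ x = 0 := by
  simp only [normPart, Submodule.mem_iInf, LinearMap.mem_ker]

lemma face_zero_mem_normPart {x : V _⦋n + 1⦌} (hx : x ∈ normPart V (n + 1)) :
    face V 0 x ∈ normPart V n := by
  cases n with
  | zero => trivial
  | succ n =>
    rw [mem_normPart_succ] at hx ⊢
    intro i
    have h : face V 0 (face V i.succ.succ x) = face V i.succ (face V 0 x) :=
      face_face V (Fin.zero_le i.succ) x
    rw [← h, hx, map_zero]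

/-- The differential `f_0` of the normalized complex. -/
def normDiff (V : SVect.{u}) (n : ℕ) : normPart V (n + 1) →ₗ[ℝ] normPart V n :=
  (face V 0).restrict fun _ => face_zero_mem_normPart

@[simp] lemma coe_normDiff (x : normPart V (n + 1)) :
    (normDiff V n x : V _⦋n⦌) = face V 0 (x : V _⦋n + 1⦌) := rfl

lemma altFace_eq_d (V : SVect.{u}) (n : ℕ) :
    altFace V n = ((AlternatingFaceMapComplex.obj V).d (n + 1) n).hom := by
  rw [AlternatingFaceMapComplex.obj_d_eq, ModuleCat.hom_sum]
  rfl

lemma altFace_of_mem_normPart {x : V _⦋n + 1⦌} (hx : x ∈ normPart V (n + 1)) :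
    altFace V n x = face V 0 x := by
  rw [altFace, LinearMap.sum_apply, Fin.sum_univ_succ]
  simp [mem_normPart_succ.1 hx]

/-- The projection of `V_n` onto its normalized subspace along the degenerate simplices. -/
def projNorm (V : SVect.{u}) (n : ℕ) : V _⦋n⦌ →ₗ[ℝ] normPart V n :=
  ((DoldKan.PInfty (X := V)).f n).hom.codRestrict _ fun x => by
    cases n with
    | zero => trivial
    | succ n =>
      rw [mem_normPart_succ]
      intro i
      exact ConcreteCategory.congr_hom
        (DoldKan.HigherFacesVanish.of_P (X := V) (n + 1) n i (by lia)) x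

@[simp] lemma projNorm_degen (i : Fin (n + 1)) (x : V _⦋n⦌) :
    projNorm V (n + 1) (degen V i x) = 0 :=
  Subtype.ext (ConcreteCategory.congr_hom (DoldKan.σ_comp_PInfty V i) x)

lemma projNorm_altFace (x : V _⦋n + 1⦌) :
    projNorm V n (altFace V n x) = normDiff V n (projNorm V (n + 1) x) := by
  ext
  rw [coe_normDiff, ← altFace_of_mem_normPart (projNorm V (n + 1) x).2, altFace_eq_d]
  exact (ConcreteCategory.congr_hom ((DoldKan.PInfty (X := V)).comm (n + 1) n) x).symm

lemma face_zero_projNorm_one (θ : V _⦋1⦌) : face V 0 (projNorm V 1 θ) = altFace V 0 θ :=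
  congrArg Subtype.val (projNorm_altFace θ).symm

lemma degen_mem_degenerate (i : Fin (n + 1)) (x : V _⦋n⦌) : degen V i x ∈ degenerate V n :=
  Submodule.mem_iSup_of_mem i ⟨x, rfl⟩

lemma sub_projNorm_mem_degenerate (x : V _⦋n + 1⦌) :
    x - projNorm V (n + 1) x ∈ degenerate V n := by
  have hQ : x - projNorm V (n + 1) x = ((DoldKan.QInfty (X := V)).f (n + 1)).hom x :=
    sub_eq_of_eq_add'
      (ConcreteCategory.congr_hom (DoldKan.PInfty_f_add_QInfty_f (X := V) (n + 1)) x).symm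
  rw [hQ, DoldKan.QInfty_f, DoldKan.decomposition_Q, ModuleCat.hom_sum, LinearMap.sum_apply]
  exact Submodule.sum_mem _ fun i _ => degen_mem_degenerate _ _

lemma degenerate_le_ker {M : Type*} [AddCommGroup M] [Module ℝ M] {f : V _⦋n + 1⦌ →ₗ[ℝ] M}
    (hf : ∀ i x, f (degen V i x) = 0) : degenerate V n ≤ LinearMap.ker f :=
  iSup_le fun i => LinearMap.range_le_iff_comap.2 (Submodule.eq_top_iff'.2 (hf i))

lemma apply_projNorm_of_degen {M : Type*} [AddCommGroup M] [Module ℝ M]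
    {f : V _⦋n + 1⦌ →ₗ[ℝ] M} (hf : ∀ i x, f (degen V i x) = 0) (x : V _⦋n + 1⦌) :
    f (projNorm V (n + 1) x) = f x := by
  have hx : f (x - projNorm V (n + 1) x) = 0 :=
    degenerate_le_ker hf (sub_projNorm_mem_degenerate x)
  rw [map_sub, sub_eq_zero] at hx
  exact hx.symm

lemma mem_degenerate_iff {x : V _⦋n + 1⦌} : x ∈ degenerate V n ↔ projNorm V (n + 1) x = 0 where
  mp hx := degenerate_le_ker projNorm_degen hx
  mpr hx := by
    simpa only [hx, ZeroMemClass.coe_zero, sub_zero] using sub_projNorm_mem_degenerate x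

@[simp] lemma projNorm_coe (x : normPart V n) : projNorm V n (x : V _⦋n⦌) = x := by
  ext
  cases n with
  | zero => rfl
  | succ n =>
    let ι : ModuleCat.of ℝ (normPart V (n + 1)) ⟶ V _⦋n + 1⦌ :=
      ModuleCat.ofHom (normPart V (n + 1)).subtype
    have hι : DoldKan.HigherFacesVanish (n + 1) ι := fun i _ =>
      ModuleCat.hom_ext (LinearMap.ext fun x => mem_normPart_succ.1 x.2 i)
    exact ConcreteCategory.congr_hom hι.comp_P_eq_self x

/-- The inclusion into `V_n` of the `n`-th term of Mathlib's normalized Moore complex, which is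
defined through the subobject lattice. -/
def mooreArrow (V : SVect.{u}) (n : ℕ) :
    ((normalizedMooreComplex (ModuleCat.{u} ℝ)).obj V).X n ⟶ V _⦋n⦌ :=
  (NormalizedMooreComplex.objX V n).arrow

instance (n : ℕ) : Mono (mooreArrow V n) :=
  inferInstanceAs (Mono (NormalizedMooreComplex.objX V n).arrow)

lemma factors_mooreArrow_iff {X : ModuleCat.{u} ℝ} (g : X ⟶ V _⦋n⦌) :
    (NormalizedMooreComplex.objX V n).Factors g ↔ ∀ x, g.hom x ∈ normPart V n := by
  cases n with
  | zero => exact iff_of_true (Subobject.top_factors g) fun _ => trivial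
  | succ n =>
    rw [NormalizedMooreComplex.objX, Subobject.finset_inf_factors]
    simp only [Finset.mem_univ, true_implies, Limits.kernelSubobject_factors_iff,
      mem_normPart_succ]
    rw [forall_comm]
    exact forall_congr' fun i => ModuleCat.hom_ext_iff.trans LinearMap.ext_iff

lemma range_mooreArrow (V : SVect.{u}) (n : ℕ) :
    LinearMap.range (mooreArrow V n).hom = normPart V n := by
  refine le_antisymm ?_ fun x hx => ?_
  · rintro _ ⟨x, rfl⟩
    exact (factors_mooreArrow_iff _).1
      ((Subobject.factors_iff _ _).2 ⟨𝟙 _, Category.id_comp _⟩) x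
  · let ι : ModuleCat.of ℝ (normPart V n) ⟶ V _⦋n⦌ := ModuleCat.ofHom (normPart V n).subtype
    have hι : (NormalizedMooreComplex.objX V n).Factors ι :=
      (factors_mooreArrow_iff ι).2 Subtype.prop
    exact ⟨Subobject.factorThru _ ι hι ⟨x, hx⟩,
      ConcreteCategory.congr_hom (Subobject.factorThru_arrow _ ι hι) ⟨x, hx⟩⟩

lemma map_comp_mooreArrow (φ : V ⟶ V') (n : ℕ) :
    ((normalizedMooreComplex (ModuleCat.{u} ℝ)).map φ).f n ≫ mooreArrow V' n =
      mooreArrow V n ≫ φ.app (Opposite.op ⦋n⦌) := by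
  rw [normalizedMooreComplex_map, NormalizedMooreComplex.map_f]
  exact Subobject.factorThru_arrow _ _ _

/-- The identification of the terms of Mathlib's normalized Moore complex with the normalized
subspaces. -/
def mooreEquiv (V : SVect.{u}) (n : ℕ) :
    ((normalizedMooreComplex (ModuleCat.{u} ℝ)).obj V).X n ≃ₗ[ℝ] normPart V n :=
  (LinearEquiv.ofInjective (mooreArrow V n).hom
    ((ModuleCat.mono_iff_injective _).1 inferInstance)).trans
      (LinearEquiv.ofEq _ _ (range_mooreArrow V n))

lemma mooreEquiv_d (x) :
    mooreEquiv V n ((((normalizedMooreComplex (ModuleCat.{u} ℝ)).obj V).d (n + 1) n).hom x) =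
      normDiff V n (mooreEquiv V (n + 1) x) := by
  ext
  rw [coe_normDiff, ← altFace_of_mem_normPart (mooreEquiv V (n + 1) x).2, altFace_eq_d]
  exact (ConcreteCategory.congr_hom ((inclusionOfMooreComplexMap V).comm (n + 1) n) x).symm

lemma mooreEquiv_map (φ : V ⟶ V') (x) :
    (mooreEquiv V' n ((((normalizedMooreComplex (ModuleCat.{u} ℝ)).map φ).f n).hom x) : V' _⦋n⦌) =
      level φ n (mooreEquiv V n x : V _⦋n⦌) :=
  ConcreteCategory.congr_hom (map_comp_mooreArrow φ n) x

instance : (normalizedMooreComplex (ModuleCat.{u} ℝ)).IsEquivalence :=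
  inferInstanceAs (Abelian.DoldKan.equivalence (A := ModuleCat.{u} ℝ)).functor.IsEquivalence

theorem exists_iso_of_normPart_equiv (e : ∀ n, normPart V n ≃ₗ[ℝ] normPart V' n)
    (he : ∀ n x, e n (normDiff V n x) = normDiff V' n (e (n + 1) x)) :
    ∃ φ : V ≅ V', ∀ n (x : normPart V n), level φ.hom n x = e n x := by
  let N := normalizedMooreComplex (ModuleCat.{u} ℝ)
  let c n : (N.obj V).X n ≃ₗ[ℝ] (N.obj V').X n :=
    mooreEquiv V n ≪≫ₗ e n ≪≫ₗ (mooreEquiv V' n).symm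
  have hc : ∀ n x, mooreEquiv V' n (c n x) = e n (mooreEquiv V n x) := fun n x =>
    (mooreEquiv V' n).apply_symm_apply _
  let ψ : N.obj V ≅ N.obj V' := HomologicalComplex.Hom.isoOfComponents
    (fun n => (c n).toModuleIso) (by
      rintro _ n rfl
      ext x
      apply (mooreEquiv V' n).injective
      have hd : normDiff V' n (mooreEquiv V' (n + 1) (c (n + 1) x)) =
          mooreEquiv V' n (c n (((N.obj V).d (n + 1) n).hom x)) := by
        rw [hc, hc, mooreEquiv_d, he]
      exact (mooreEquiv_d _).trans hd)
  refine ⟨N.preimageIso ψ, fun n x => ?_⟩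
  obtain ⟨x, rfl⟩ := (mooreEquiv V n).surjective x
  rw [← hc, ← mooreEquiv_map, Functor.preimageIso_hom, Functor.map_preimage]
  rfl

theorem exists_normPart_equiv (C : ChainComplex (ModuleCat.{u} ℝ) ℕ) :
    ∃ (V : SVect.{u}) (e : ∀ n, C.X n ≃ₗ[ℝ] normPart V n),
      ∀ n x, normDiff V n (e (n + 1) x) = e n ((C.d (n + 1) n).hom x) := by
  let N := normalizedMooreComplex (ModuleCat.{u} ℝ)
  let ψ : C ≅ N.obj (N.objPreimage C) := (N.objObjPreimageIso C).symm
  refine ⟨N.objPreimage C, fun n =>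
    ((HomologicalComplex.eval _ _ n).mapIso ψ).toLinearEquiv ≪≫ₗ mooreEquiv _ n, fun n x => ?_⟩
  exact (mooreEquiv_d _).symm.trans (congrArg (mooreEquiv (N.objPreimage C) n)
    (ConcreteCategory.congr_hom (ψ.hom.comm (n + 1) n) x))

end DoldKan

section Normalized

variable {V : SVect.{u}}

lemma IsLinearTwoGroupoid.normPart_eq_bot (h : IsLinearTwoGroupoid V) (n : ℕ) :
    normPart V (n + 3) = ⊥ := by
  refine (Submodule.eq_bot_iff _).2 fun x hx => ?_
  refine (h.horn_bij (n + 2) 0 (by lia)).injOn trivial trivial (funext fun ⟨i, hi⟩ => ?_)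
  obtain ⟨j, rfl⟩ := Fin.exists_succ_eq.2 hi
  simp only [hornMap, mem_normPart_succ.1 hx j, map_zero]

lemma finiteDimensional_of_normPart (h : ∀ n, FiniteDimensional ℝ (normPart V n)) (n : ℕ) :
    FiniteDimensional ℝ (V _⦋n⦌) := by
  induction n with
  | zero =>
    have : FiniteDimensional ℝ (⊤ : Submodule ℝ (V _⦋0⦌)) := h 0
    exact Module.Finite.equiv (Submodule.topEquiv : _ ≃ₗ[ℝ] V _⦋0⦌)
  | succ n ih =>
    let faces : V _⦋n + 1⦌ →ₗ[ℝ] (Fin (n + 1) → V _⦋n⦌) := LinearMap.pi fun i => face V i.succ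
    have hker : LinearMap.ker faces = normPart V (n + 1) := LinearMap.ker_pi _
    have : FiniteDimensional ℝ (LinearMap.ker faces) := hker ▸ h (n + 1)
    have := Module.Finite.equiv faces.quotKerEquivRange.symm
    exact Module.Finite.of_submodule_quotient (LinearMap.ker faces)

lemma isLinearTwoGroupoid_of_normPart (h : ∀ n, FiniteDimensional ℝ (normPart V n))
    (h₃ : ∀ n, normPart V (n + 3) = ⊥) : IsLinearTwoGroupoid V where
  finite := finiteDimensional_of_normPart h
  horn_surj := surjOn_hornMap V
  horn_bij n k hn := by
    refine ⟨fun x _ => hornMap_mem_hornSpace n k x, fun x _ y _ hxy => ?_, surjOn_hornMap V n k⟩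
    obtain ⟨m, rfl⟩ : ∃ m, n = m + 2 := ⟨n - 2, by lia⟩
    refine sub_eq_zero.1 (eq_zero_of_face_eq_zero (fun x hx => ?_) k _ fun i hi => ?_)
    · exact (Submodule.eq_bot_iff _).1 (h₃ m) x (mem_normPart_succ.2 hx)
    · rw [map_sub, sub_eq_zero]
      exact congrFun hxy ⟨i, hi⟩

end Normalized

section Pairings

variable {V : SVect.{u}}

/-- The properties shared by the pairings `A_ω` and `B_ω` of all normalized cocycles `ω`: `B` is
symmetric, both descend to the quotients by the degenerate subspaces, and the alternating sums of
the faces are adjoint to each other. -/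
structure CompatiblePairings (A : V _⦋0⦌ →ₗ[ℝ] V _⦋2⦌ →ₗ[ℝ] ℝ)
    (B : LinearMap.BilinForm ℝ (V _⦋1⦌)) : Prop where
  symm : ∀ θ η, B θ η = B η θ
  degen_right : ∀ i v θ, A v (degen V i θ) = 0
  degen_left : ∀ v θ, B (degen V 0 v) θ = 0
  adjoint : ∀ θ z, B θ (altFace V 1 z) = A (altFace V 0 θ) z

lemma IsNormalizedCocycle.compatiblePairings {ω : LinearMap.BilinForm ℝ (V _⦋2⦌)}
    (h : IsNormalizedCocycle V ω) : CompatiblePairings (formA ω) (formB ω) where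
  symm _ _ := add_comm _ _
  degen_right := h.formA_degen
  degen_left := h.formB_degen
  adjoint := h.formB_altFace

namespace CompatiblePairings

lemma of_normPart {a : V _⦋0⦌ →ₗ[ℝ] normPart V 2 →ₗ[ℝ] ℝ}
    {b : LinearMap.BilinForm ℝ (normPart V 1)} (hb : ∀ u u', b u u' = b u' u)
    (hab : ∀ u z, b u (normDiff V 1 z) = a (face V 0 u) z) :
    CompatiblePairings (a.compl₂ (projNorm V 2)) (b.compl₁₂ (projNorm V 1) (projNorm V 1)) where
  symm _ _ := hb _ _
  degen_right i v θ := by rw [LinearMap.compl₂_apply, projNorm_degen, map_zero]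
  degen_left v θ := by
    rw [LinearMap.compl₁₂_apply, projNorm_degen, map_zero, LinearMap.zero_apply]
  adjoint θ z := by
    rw [LinearMap.compl₁₂_apply, projNorm_altFace, hab, face_zero_projNorm_one,
      LinearMap.compl₂_apply]

variable {A : V _⦋0⦌ →ₗ[ℝ] V _⦋2⦌ →ₗ[ℝ] ℝ} {B : LinearMap.BilinForm ℝ (V _⦋1⦌)}
  (h : CompatiblePairings A B)
include h

lemma apply_projNorm_right (v : V _⦋0⦌) (z : V _⦋2⦌) : A v (projNorm V 2 z) = A v z :=
  apply_projNorm_of_degen (fun i => h.degen_right i v) z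

lemma apply_projNorm_left (θ η : V _⦋1⦌) : B (projNorm V 1 θ) η = B θ η :=
  apply_projNorm_of_degen (f := B.flip η) (fun i v => by
    rw [Fin.eq_zero i]
    exact h.degen_left v η) θ

lemma apply_projNorm (θ η : V _⦋1⦌) : B (projNorm V 1 θ) (projNorm V 1 η) = B θ η := by
  rw [h.apply_projNorm_left, h.symm, h.apply_projNorm_left, h.symm]

lemma apply_normDiff (u : normPart V 1) (z : normPart V 2) :
    B u (normDiff V 1 z) = A (face V 0 u) z := by
  rw [coe_normDiff, ← altFace_of_mem_normPart z.2, h.adjoint, altFace_of_mem_normPart u.2]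

lemma adjoint_faces (θ : V _⦋1⦌) (z : V _⦋2⦌) :
    B θ (face V 0 z) - B θ (face V 1 z) + B θ (face V 2 z) =
      A (face V 0 θ) z - A (face V 1 θ) z := by
  simpa only [altFace_one, altFace_zero, map_sub, map_add, LinearMap.sub_apply] using h.adjoint θ z

lemma apply_altFace_two (h₃ : normPart V 3 = ⊥) (v : V _⦋0⦌) (x : V _⦋3⦌) :
    A v (altFace V 2 x) = 0 := by
  have hx : projNorm V 3 x = 0 := Subtype.ext ((Submodule.eq_bot_iff _).1 h₃ _ (projNorm V 3 x).2)
  rw [← h.apply_projNorm_right, projNorm_altFace, hx, map_zero, ZeroMemClass.coe_zero, map_zero]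

end CompatiblePairings

end Pairings

section Construction

variable {V : SVect.{u}} {A : V _⦋0⦌ →ₗ[ℝ] V _⦋2⦌ →ₗ[ℝ] ℝ} {B : LinearMap.BilinForm ℝ (V _⦋1⦌)}

/-- The bilinear form `A(x₁, y) - A(y₂, x) + B(x₀₁, y₀₂ - y₀₁)` on `V₂`, indices denoting the
vertices and edges of 2-simplices. It is a cocycle, but neither normalized nor alternating. -/
def cupForm (A : V _⦋0⦌ →ₗ[ℝ] V _⦋2⦌ →ₗ[ℝ] ℝ) (B : LinearMap.BilinForm ℝ (V _⦋1⦌)) :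
    LinearMap.BilinForm ℝ (V _⦋2⦌) :=
  A ∘ₗ face V 0 ∘ₗ face V 2 - (A ∘ₗ face V 0 ∘ₗ face V 1).flip
    + B.compl₁₂ (face V 2) (face V 1 - face V 2)

/-- A normalized cocycle with pairings `A` and `B`. -/
def cocycleOf (A : V _⦋0⦌ →ₗ[ℝ] V _⦋2⦌ →ₗ[ℝ] ℝ) (B : LinearMap.BilinForm ℝ (V _⦋1⦌)) :
    LinearMap.BilinForm ℝ (V _⦋2⦌) :=
  cupForm A B + constCobdry ((2⁻¹ : ℝ) • B)

lemma cupForm_apply (x y : V _⦋2⦌) :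
    cupForm A B x y = A (face V 0 (face V 2 x)) y - A (face V 0 (face V 1 y)) x
      + (B (face V 2 x) (face V 1 y) - B (face V 2 x) (face V 2 y)) := by
  simp [cupForm]

lemma cocycleOf_apply (x y : V _⦋2⦌) :
    cocycleOf A B x y = A (face V 0 (face V 2 x)) y - A (face V 0 (face V 1 y)) x
      + B (face V 2 x) (face V 1 y)
      + (B (face V 0 x) (face V 0 y) - B (face V 1 x) (face V 1 y)
        - B (face V 2 x) (face V 2 y)) / 2 := by
  rw [cocycleOf, LinearMap.add_apply, LinearMap.add_apply, cupForm_apply, constCobdry_one_apply]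
  simp only [LinearMap.smul_apply, smul_eq_mul]
  ring

namespace CompatiblePairings

variable (h : CompatiblePairings A B)
include h

lemma degen_zero_right (v : V _⦋0⦌) (θ : V _⦋1⦌) : B θ (degen V 0 v) = 0 := by
  rw [h.symm, h.degen_left]

lemma constCobdry_cupForm (h₃ : normPart V 3 = ⊥) : constCobdry (cupForm A B) = 0 := by
  ext x y
  have cocycle_y := h.apply_altFace_two h₃ (face V 1 (face V 0 (face V 0 x))) y
  have cocycle_x := h.apply_altFace_two h₃ (face V 0 (face V 0 (face V 0 y))) x
  have adj_y₃ := h.adjoint_faces (face V 2 (face V 0 x)) (face V 3 y)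
  have adj_y₂ := h.adjoint_faces (face V 2 (face V 0 x)) (face V 2 y)
  have adj_x₀₃ := h.adjoint_faces (face V 1 (face V 1 y)) (face V 3 x)
  have adj_x₀₂ := h.adjoint_faces (face V 2 (face V 1 y)) (face V 3 x)
  simp only [altFace_two, map_sub, map_add, face_zero_face_one, face_zero_face_two,
    face_one_face_two, face_zero_face_three, face_one_face_three, face_two_face_three,
    h.symm (face V _ (face V 1 y))]
    at cocycle_y cocycle_x adj_y₃ adj_y₂ adj_x₀₃ adj_x₀₂
  simp only [constCobdry_two_apply, cupForm_apply, face_zero_face_one, face_zero_face_two,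
    face_one_face_two, face_one_face_three, face_two_face_three, LinearMap.zero_apply]
  linarith

lemma isAlt_cocycleOf : (cocycleOf A B).IsAlt := by
  intro x
  -- The alternating sum `dx` of the faces satisfies `ω(x, x) = -B(dx, dx) / 2 = -A(ddx, x) / 2`.
  have hd : altFace V 0 (altFace V 1 x) = 0 := by simp [altFace_zero, altFace_one]
  have hB : B (altFace V 1 x) (altFace V 1 x) = 0 := by
    rw [h.adjoint, hd, map_zero, LinearMap.zero_apply]
  have adj := h.adjoint_faces (face V 0 x) x
  simp only [altFace_one, map_sub, map_add, LinearMap.sub_apply, LinearMap.add_apply] at hB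
  rw [cocycleOf_apply, face_zero_face_one, face_zero_face_two]
  linarith [h.symm (face V 1 x) (face V 0 x), h.symm (face V 2 x) (face V 0 x),
    h.symm (face V 2 x) (face V 1 x)]

lemma isNormalizedCocycle_cocycleOf (h₃ : normPart V 3 = ⊥) :
    IsNormalizedCocycle V (cocycleOf A B) where
  alt := h.isAlt_cocycleOf
  mult := by
    have hadd (α β : LinearMap.BilinForm ℝ (V _⦋2⦌)) :
        constCobdry (α + β) = constCobdry α + constCobdry β := cobdry_add _ _ _
    rw [cocycleOf, hadd, h.constCobdry_cupForm h₃, constCobdry_constCobdry, add_zero]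
  norm_zero θ η := by
    simp only [cocycleOf_apply, h.degen_right, h.degen_left, face_zero_degen_zero,
      face_one_degen_zero, face_two_degen_zero]
    ring
  norm_one θ η := by
    simp only [cocycleOf_apply, h.degen_right, h.degen_left, face_zero_degen_one,
      face_one_degen_one, face_two_degen_one]
    ring

lemma formA_cocycleOf : formA (cocycleOf A B) = A := by
  ext v z
  simp [formA_apply, cocycleOf_apply, h.degen_right, h.degen_left]

lemma formB_cocycleOf : formB (cocycleOf A B) = B := by
  ext θ η
  simp only [formB_apply, crossForm_apply, cocycleOf_apply, h.degen_right, h.degen_left,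
    h.degen_zero_right, h.symm η θ, face_zero_degen_zero, face_one_degen_zero,
    face_two_degen_zero, face_zero_degen_one, face_one_degen_one, face_two_degen_one]
  ring

end CompatiblePairings

end Construction

section Nondegeneracy

variable {V : SVect.{u}} {ω : LinearMap.BilinForm ℝ (V _⦋2⦌)}

/-- The restriction of `A_ω` to the normalized complex. -/
def normA (ω : LinearMap.BilinForm ℝ (V _⦋2⦌)) : V _⦋0⦌ →ₗ[ℝ] normPart V 2 →ₗ[ℝ] ℝ :=
  (formA ω).domRestrict₂ (normPart V 2)

/-- The restriction of `B_ω` to the normalized complex. -/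
def normB (ω : LinearMap.BilinForm ℝ (V _⦋2⦌)) : LinearMap.BilinForm ℝ (normPart V 1) :=
  (formB ω).restrict (normPart V 1)

lemma normA_apply (v : V _⦋0⦌) (z : normPart V 2) : normA ω v z = formA ω v z := rfl

lemma normB_apply (u u' : normPart V 1) : normB ω u u' = formB ω u u' := rfl

lemma isSymm_normB : (normB ω).IsSymm := ⟨fun _ _ => add_comm _ _⟩

namespace IsNormalizedCocycle

variable (h : IsNormalizedCocycle V ω)
include h

lemma normA_projNorm (v : V _⦋0⦌) (z : V _⦋2⦌) : normA ω v (projNorm V 2 z) = formA ω v z :=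
  h.compatiblePairings.apply_projNorm_right v z

lemma normB_projNorm (θ η : V _⦋1⦌) :
    normB ω (projNorm V 1 θ) (projNorm V 1 η) = formB ω θ η :=
  h.compatiblePairings.apply_projNorm θ η

lemma normB_normDiff (u : normPart V 1) (z : normPart V 2) :
    normB ω u (normDiff V 1 z) = normA ω (face V 0 u) z :=
  h.compatiblePairings.apply_normDiff u z

lemma simpliciallyNondegenerate_iff [FiniteDimensional ℝ (V _⦋0⦌)] :
    SimpliciallyNondegenerate V (constForm ω) ↔
      (normA ω).IsPerfPair ∧ (normB ω).Nondegenerate where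
  mp hω := by
    refine ⟨.of_injective ?_ ?_,
      (isSymm_normB.isRefl.nondegenerate_iff_separatingLeft).2 fun u hu => ?_⟩
    · refine (injective_iff_map_eq_zero _).2 fun v hv => hω.left_A 0 v fun z => ?_
      exact (h.normA_projNorm v z).symm.trans (LinearMap.congr_fun hv _)
    · refine (injective_iff_map_eq_zero _).2 fun z hz => ?_
      rw [← projNorm_coe z]
      exact mem_degenerate_iff.1 (hω.right_A 0 z fun v => LinearMap.congr_fun hz v)
    · rw [← projNorm_coe u]
      refine mem_degenerate_iff.1 (hω.nondeg_B 0 u fun η => ?_)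
      exact (h.normB_projNorm u η).symm.trans ((projNorm_coe u).symm ▸ hu (projNorm V 1 η))
  mpr hω := by
    have := hω.1
    refine ⟨fun _ v hv => ?_, fun _ z hz => ?_, fun _ θ hθ => ?_⟩
    · exact (injective_iff_map_eq_zero _).1
        (LinearMap.IsPerfPair.bijective_left (normA ω)).injective v (LinearMap.ext (hv ·))
    · refine mem_degenerate_iff.2 <| (injective_iff_map_eq_zero _).1
        (LinearMap.IsPerfPair.bijective_right (normA ω)).injective _ (LinearMap.ext fun v => ?_)
      exact (h.normA_projNorm v z).trans (hz v)
    · refine mem_degenerate_iff.2 (hω.2.1 _ fun u => ?_)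
      rw [← projNorm_coe u, h.normB_projNorm]
      exact hθ u

end IsNormalizedCocycle

variable (V) in
/-- The two models of `V₁` modulo degenerate simplices: `ker f₀`, which enters the tuple, and
`ker f₁`, which enters the normalized complex. -/
def kerFaceEquiv : kerFace V ≃ₗ[ℝ] normPart V 1 :=
  .ofLinearMap (projNorm V 1 ∘ₗ (kerFace V).subtype) (projKerFace V ∘ₗ (normPart V 1).subtype)
    (by
      ext u
      simp [coe_projKerFace])
    (by
      ext w
      have hproj : projKerFace V (projNorm V 1 w) = projKerFace V w :=
        apply_projNorm_of_degen (fun i v => by rw [Fin.eq_zero i, projKerFace_degen]) _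
      exact congrArg Subtype.val (hproj.trans (projKerFace_coe w)))

lemma coe_kerFaceEquiv (w : kerFace V) :
    (kerFaceEquiv V w : V _⦋1⦌) = projNorm V 1 (w : V _⦋1⦌) := rfl

lemma face_zero_kerFaceEquiv (w : kerFace V) :
    face V 0 (kerFaceEquiv V w : V _⦋1⦌) = -face V 1 (w : V _⦋1⦌) := by
  have hw : face V 0 (w : V _⦋1⦌) = 0 := w.2
  rw [coe_kerFaceEquiv, face_zero_projNorm_one, altFace_zero, hw, zero_sub]

lemma IsNormalizedCocycle.normB_kerFaceEquiv (h : IsNormalizedCocycle V ω) (w w' : kerFace V) :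
    normB ω (kerFaceEquiv V w) (kerFaceEquiv V w') = formB ω w w' :=
  h.normB_projNorm w w'

end Nondegeneracy

section Data

lemma transposeVia_eq_iff {W₁ W₀ : Type*} [AddCommGroup W₁] [Module ℝ W₁]
    [FiniteDimensional ℝ W₁] [AddCommGroup W₀] [Module ℝ W₀] {b : LinearMap.BilinForm ℝ W₁}
    (hb : b.Nondegenerate) {bd : W₁ →ₗ[ℝ] W₀} {ξ : Module.Dual ℝ W₀} {w : W₁} :
    transposeVia b hb bd ξ = w ↔ ∀ w', b w w' = ξ (bd w') := by
  rw [transposeVia, LinearMap.comp_apply, LinearEquiv.coe_coe, LinearEquiv.symm_apply_eq,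
    eq_comm, LinearMap.ext_iff]
  rfl

namespace ConstSympGpd

variable (G : ConstSympGpd.{u})

instance (n : ℕ) : FiniteDimensional ℝ (G.V _⦋n⦌) := G.isLinear.finite n

lemma isNormalizedCocycle : IsNormalizedCocycle G.V G.ω :=
  (isSymplecticForm_constForm_iff.1 G.isSymplectic).1

lemma isPerfPair_normA_and_nondegenerate_normB :
    (normA G.ω).IsPerfPair ∧ (normB G.ω).Nondegenerate :=
  G.isNormalizedCocycle.simpliciallyNondegenerate_iff.1 G.isSymplectic.nondeg

instance : (normA G.ω).IsPerfPair := G.isPerfPair_normA_and_nondegenerate_normB.1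

lemma nondegenerate_normB : (normB G.ω).Nondegenerate :=
  G.isPerfPair_normA_and_nondegenerate_normB.2

lemma hasData_iff {G : ConstSympGpd.{u}} {T : LinData.{u}} :
    HasData G T ↔ ∃ (e₁ : T.W₁ ≃ₗ[ℝ] normPart G.V 1) (e₀ : T.W₀ ≃ₗ[ℝ] G.V _⦋0⦌),
      (∀ w w', T.pairing w w' = normB G.ω (e₁ w) (e₁ w')) ∧
      ∀ w, e₀ (T.bd w) = face G.V 0 (e₁ w : G.V _⦋1⦌) where
  mp := fun ⟨e₁, e₀, hpairing, hbd⟩ => by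
    refine ⟨e₁ ≪≫ₗ kerFaceEquiv G.V, e₀, fun w w' => ?_, fun w => ?_⟩
    · rw [LinearEquiv.trans_apply, LinearEquiv.trans_apply,
        G.isNormalizedCocycle.normB_kerFaceEquiv, hpairing, pairB_constForm]
    · rw [LinearEquiv.trans_apply, face_zero_kerFaceEquiv, hbd]
  mpr := fun ⟨e₁, e₀, hpairing, hbd⟩ => by
    refine ⟨e₁ ≪≫ₗ (kerFaceEquiv G.V).symm, e₀, fun w w' => ?_, fun w => ?_⟩
    · rw [pairB_constForm, ← G.isNormalizedCocycle.normB_kerFaceEquiv, LinearEquiv.trans_apply,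
        LinearEquiv.trans_apply, LinearEquiv.apply_symm_apply, LinearEquiv.apply_symm_apply,
        hpairing]
    · rw [← face_zero_kerFaceEquiv, LinearEquiv.trans_apply, LinearEquiv.apply_symm_apply, hbd]

/-- The differential `∂ = f₀` from degree 1 to degree 0 of the normalized complex. -/
def bd : normPart G.V 1 →ₗ[ℝ] G.V _⦋0⦌ := (face G.V 0).domRestrict (normPart G.V 1)

lemma bd_apply (u : normPart G.V 1) : G.bd u = face G.V 0 (u : G.V _⦋1⦌) := rfl

lemma bd_normDiff (z : normPart G.V 2) : G.bd (normDiff G.V 1 z) = 0 := by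
  have hz : face G.V 1 (z : G.V _⦋2⦌) = 0 := mem_normPart_succ.1 z.2 0
  rw [bd_apply, coe_normDiff, ← face_zero_face_one, hz, map_zero]

lemma transposeVia_normA_flip (z : normPart G.V 2) :
    transposeVia (normB G.ω) G.nondegenerate_normB G.bd ((normA G.ω).flip z) =
      normDiff G.V 1 z :=
  (transposeVia_eq_iff _).2 fun u =>
    (isSymm_normB.eq _ _).trans (G.isNormalizedCocycle.normB_normDiff u z)

/-- The tuple of a constant symplectic 2-groupoid, with `ker f₁` as the model of `W₁`. -/
def data : LinData.{u} where
  W₁ := normPart G.V 1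
  W₀ := G.V _⦋0⦌
  pairing := normB G.ω
  symm := isSymm_normB
  nondeg := G.nondegenerate_normB
  bd := G.bd
  isotropic := by
    rintro _ ⟨ξ, rfl⟩ _ ⟨ξ', rfl⟩
    obtain ⟨z, rfl⟩ := (LinearMap.IsPerfPair.bijective_right (normA G.ω)).surjective ξ
    obtain ⟨z', rfl⟩ := (LinearMap.IsPerfPair.bijective_right (normA G.ω)).surjective ξ'
    rw [transposeVia_normA_flip, transposeVia_normA_flip, G.isNormalizedCocycle.normB_normDiff]
    exact (congrArg (normA G.ω · z') (G.bd_normDiff z)).trans (LinearMap.map_zero₂ _ _)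

lemma hasData_data : HasData G G.data :=
  hasData_iff.2 ⟨.refl _ _, .refl _ _, fun _ _ => rfl, fun _ => rfl⟩

end ConstSympGpd

namespace HasData

variable {G G' : ConstSympGpd.{u}} {T T' : LinData.{u}}

lemma isomorphic (h : HasData G T) (h' : HasData G T') : T.Isomorphic T' := by
  obtain ⟨e₁, e₀, hpairing, hbd⟩ := h
  obtain ⟨e₁', e₀', hpairing', hbd'⟩ := h'
  refine ⟨e₁ ≪≫ₗ e₁'.symm, e₀ ≪≫ₗ e₀'.symm, fun w w' => ?_, fun w => e₀'.injective ?_⟩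
  · simp only [hpairing', hpairing, LinearEquiv.trans_apply, LinearEquiv.apply_symm_apply]
  · simp only [hbd', hbd, LinearEquiv.trans_apply, LinearEquiv.apply_symm_apply]

lemma of_isomorphic (h : HasData G T) (h' : T'.Isomorphic T) : HasData G T' := by
  obtain ⟨e₁, e₀, hpairing, hbd⟩ := h
  obtain ⟨g₁, g₀, hpairing', hbd'⟩ := h'
  refine ⟨g₁ ≪≫ₗ e₁, g₀ ≪≫ₗ e₀, fun w w' => ?_, fun w => ?_⟩
  · rw [← hpairing', hpairing]
    rfl
  · rw [LinearEquiv.trans_apply, ← hbd', hbd]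
    rfl

end HasData

/-- The components of an isomorphism of simplicial vector spaces. -/
def levelEquiv {V V' : SVect.{u}} (φ : V ≅ V') (n : ℕ) : V _⦋n⦌ ≃ₗ[ℝ] V' _⦋n⦌ :=
  (φ.app (Opposite.op ⦋n⦌)).toLinearEquiv

lemma levelEquiv_apply {V V' : SVect.{u}} (φ : V ≅ V') (n : ℕ) (x : V _⦋n⦌) :
    levelEquiv φ n x = level φ.hom n x := rfl

lemma map_kerFace_levelEquiv {V V' : SVect.{u}} (φ : V ≅ V') :
    (kerFace V).map (levelEquiv φ 1).toLinearMap = kerFace V' := by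
  ext x
  rw [Submodule.mem_map_equiv, LinearMap.mem_ker, LinearMap.mem_ker,
    ← (levelEquiv φ 0).map_eq_zero_iff, levelEquiv_apply, ← level_face, ← levelEquiv_apply,
    LinearEquiv.apply_symm_apply]

lemma HasData.of_equivalent {G G' : ConstSympGpd.{u}} {T : LinData.{u}} (h : HasData G T)
    (h' : G.Equivalent G') : HasData G' T := by
  obtain ⟨e₁, e₀, hpairing, hbd⟩ := h
  obtain ⟨φ, hφ⟩ := h'
  refine ⟨e₁ ≪≫ₗ (levelEquiv φ 1).ofSubmodules _ _ (map_kerFace_levelEquiv φ),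
    e₀ ≪≫ₗ levelEquiv φ 0, fun w w' => ?_, fun w => ?_⟩
  · rw [hpairing, ← hφ.pairB_eq]
    simp only [pairB, pullback, LinearMap.BilinForm.comp_apply, ← level_degen]
    rfl
  · rw [LinearEquiv.trans_apply, hbd, map_neg, levelEquiv_apply, ← level_face]
    rfl

end Data

section Classification

lemma exists_equiv_of_isPerfPair {R M M' N N' : Type*} [CommRing R] [AddCommGroup M] [Module R M]
    [AddCommGroup M'] [Module R M'] [AddCommGroup N] [Module R N] [AddCommGroup N'] [Module R N']
    (p : M →ₗ[R] N →ₗ[R] R) (p' : M' →ₗ[R] N' →ₗ[R] R) [p.IsPerfPair] [p'.IsPerfPair]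
    (e : M ≃ₗ[R] M') : ∃ f : N ≃ₗ[R] N', ∀ m n, p' (e m) (f n) = p m n := by
  refine ⟨p.flip.toPerfPair ≪≫ₗ e.symm.dualMap ≪≫ₗ p'.flip.toPerfPair.symm, fun m n => ?_⟩
  simp [LinearMap.apply_toPerfPair_flip]

variable {V V' : SVect.{u}}

/-- A family of equivalences of normalized subspaces, given in the degrees at most two. -/
def normPartEquivOf (g₀ : V _⦋0⦌ ≃ₗ[ℝ] V' _⦋0⦌) (g₁ : normPart V 1 ≃ₗ[ℝ] normPart V' 1)
    (g₂ : normPart V 2 ≃ₗ[ℝ] normPart V' 2) (hV : ∀ n, normPart V (n + 3) = ⊥)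
    (hV' : ∀ n, normPart V' (n + 3) = ⊥) (n : ℕ) : normPart V n ≃ₗ[ℝ] normPart V' n :=
  match n with
  | 0 => Submodule.topEquiv ≪≫ₗ g₀ ≪≫ₗ Submodule.topEquiv.symm
  | 1 => g₁
  | 2 => g₂
  | n + 3 => LinearEquiv.ofEq _ _ (hV n) ≪≫ₗ
      (0 : (⊥ : Submodule ℝ (V _⦋n + 3⦌)) ≃ₗ[ℝ] (⊥ : Submodule ℝ (V' _⦋n + 3⦌))) ≪≫ₗ
        LinearEquiv.ofEq _ _ (hV' n).symm

lemma exists_iso_of_normPart_eq_bot (hV : ∀ n, normPart V (n + 3) = ⊥)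
    (hV' : ∀ n, normPart V' (n + 3) = ⊥) (g₀ : V _⦋0⦌ ≃ₗ[ℝ] V' _⦋0⦌)
    (g₁ : normPart V 1 ≃ₗ[ℝ] normPart V' 1) (g₂ : normPart V 2 ≃ₗ[ℝ] normPart V' 2)
    (hg₁ : ∀ u : normPart V 1, g₀ (face V 0 (u : V _⦋1⦌)) = face V' 0 (g₁ u : V' _⦋1⦌))
    (hg₂ : ∀ z, g₁ (normDiff V 1 z) = normDiff V' 1 (g₂ z)) :
    ∃ φ : V ≅ V', (∀ v, level φ.hom 0 v = g₀ v) ∧ (∀ u : normPart V 1, level φ.hom 1 u = g₁ u) ∧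
      ∀ z : normPart V 2, level φ.hom 2 z = g₂ z := by
  have eq_zero {n : ℕ} (x : normPart V (n + 3)) : x = 0 :=
    Subtype.ext ((Submodule.eq_bot_iff _).1 (hV n) x x.2)
  obtain ⟨φ, hφ⟩ := exists_iso_of_normPart_equiv (normPartEquivOf g₀ g₁ g₂ hV hV') fun n x => by
    match n with
    | 0 => exact Subtype.ext (hg₁ x)
    | 1 => exact hg₂ x
    | n + 2 => simp only [eq_zero x, map_zero]
  exact ⟨φ, fun v => hφ 0 ⟨v, trivial⟩, hφ 1, hφ 2⟩

lemma formA_comp_level (φ : V ⟶ V') (ω : LinearMap.BilinForm ℝ (V' _⦋2⦌)) (v : V _⦋0⦌)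
    (z : V _⦋2⦌) :
    formA (ω.comp (level φ 2) (level φ 2)) v z = formA ω (level φ 0 v) (level φ 2 z) := by
  simp only [formA_apply, LinearMap.BilinForm.comp_apply, level_degen]

lemma formB_comp_level (φ : V ⟶ V') (ω : LinearMap.BilinForm ℝ (V' _⦋2⦌)) (θ η : V _⦋1⦌) :
    formB (ω.comp (level φ 2) (level φ 2)) θ η = formB ω (level φ 1 θ) (level φ 1 η) := by
  simp only [formB_apply, crossForm_apply, LinearMap.BilinForm.comp_apply, level_degen]

lemma IsNormalizedCocycle.formEquiv_of_norm {ω ω' : LinearMap.BilinForm ℝ (V _⦋2⦌)}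
    (h : IsNormalizedCocycle V ω) (h' : IsNormalizedCocycle V ω') (hA : normA ω' = normA ω)
    (hB : normB ω' = normB ω) : FormEquiv V (constForm ω) (constForm ω') := by
  refine h.formEquiv h' (LinearMap.ext₂ fun v z => ?_) (LinearMap.ext₂ fun θ η => ?_)
  · rw [← h.normA_projNorm, ← h'.normA_projNorm, hA]
  · rw [← h.normB_projNorm, ← h'.normB_projNorm, hB]

lemma ConstSympGpd.equivalent_of_normPart_equiv {G G' : ConstSympGpd.{u}}
    (g₀ : G.V _⦋0⦌ ≃ₗ[ℝ] G'.V _⦋0⦌) (g₁ : normPart G.V 1 ≃ₗ[ℝ] normPart G'.V 1)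
    (hpairing : ∀ u u', normB G'.ω (g₁ u) (g₁ u') = normB G.ω u u')
    (hbd : ∀ u : normPart G.V 1,
      g₀ (face G.V 0 (u : G.V _⦋1⦌)) = face G'.V 0 (g₁ u : G'.V _⦋1⦌)) :
    G.Equivalent G' := by
  obtain ⟨g₂, hg₂⟩ := exists_equiv_of_isPerfPair (normA G.ω) (normA G'.ω) g₀
  -- `f₀ : W₂ → W₁` is recovered from `f₀ : W₁ → W₀` as its adjoint, so `g₁` and `g₂` intertwine it.
  have hdiff (z : normPart G.V 2) : g₁ (normDiff G.V 1 z) = normDiff G'.V 1 (g₂ z) := by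
    refine sub_eq_zero.1 (G'.nondegenerate_normB.2 _ fun u' => ?_)
    obtain ⟨u, rfl⟩ := g₁.surjective u'
    rw [map_sub, sub_eq_zero, hpairing, G.isNormalizedCocycle.normB_normDiff,
      G'.isNormalizedCocycle.normB_normDiff, ← hbd, hg₂]
  obtain ⟨φ, hφ₀, hφ₁, hφ₂⟩ := exists_iso_of_normPart_eq_bot G.isLinear.normPart_eq_bot
    G'.isLinear.normPart_eq_bot g₀ g₁ g₂ hbd hdiff
  refine ⟨φ, G.isNormalizedCocycle.formEquiv_of_norm (G'.isNormalizedCocycle.comp_level φ.hom)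
    (LinearMap.ext₂ fun v z => ?_) (LinearMap.ext₂ fun u u' => ?_)⟩
  · rw [normA_apply, formA_comp_level, hφ₀, hφ₂, ← normA_apply, hg₂]
  · rw [normB_apply, formB_comp_level, hφ₁, hφ₁, ← normB_apply, hpairing]

lemma HasData.equivalent {G G' : ConstSympGpd.{u}} {T : LinData.{u}} (h : HasData G T)
    (h' : HasData G' T) : G.Equivalent G' := by
  obtain ⟨e₁, e₀, hpairing, hbd⟩ := ConstSympGpd.hasData_iff.1 h
  obtain ⟨e₁', e₀', hpairing', hbd'⟩ := ConstSympGpd.hasData_iff.1 h'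
  refine ConstSympGpd.equivalent_of_normPart_equiv (e₀.symm ≪≫ₗ e₀') (e₁.symm ≪≫ₗ e₁')
    (fun u u' => ?_) fun u => ?_
  · rw [LinearEquiv.trans_apply, LinearEquiv.trans_apply, ← hpairing', hpairing,
      LinearEquiv.apply_symm_apply, LinearEquiv.apply_symm_apply]
  · obtain ⟨w, rfl⟩ := e₁.surjective u
    rw [← hbd, LinearEquiv.trans_apply, LinearEquiv.symm_apply_apply, hbd',
      LinearEquiv.trans_apply, LinearEquiv.symm_apply_apply]

end Classification

section Realization

theorem exists_isNormalizedCocycle {V : SVect.{u}} (h₃ : normPart V 3 = ⊥)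
    (a : V _⦋0⦌ →ₗ[ℝ] normPart V 2 →ₗ[ℝ] ℝ) {b : LinearMap.BilinForm ℝ (normPart V 1)}
    (hb : b.IsSymm) (hab : ∀ u z, b u (normDiff V 1 z) = a (face V 0 (u : V _⦋1⦌)) z) :
    ∃ ω : LinearMap.BilinForm ℝ (V _⦋2⦌),
      IsNormalizedCocycle V ω ∧ normA ω = a ∧ normB ω = b := by
  have hAB := CompatiblePairings.of_normPart hb.eq hab
  refine ⟨_, hAB.isNormalizedCocycle_cocycleOf h₃, LinearMap.ext₂ fun v z => ?_,
    LinearMap.ext₂ fun u u' => ?_⟩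
  · rw [normA_apply, hAB.formA_cocycleOf, LinearMap.compl₂_apply, projNorm_coe]
  · rw [normB_apply, hAB.formB_cocycleOf, LinearMap.compl₁₂_apply, projNorm_coe, projNorm_coe]

end Realization

namespace LinData

variable (T : LinData.{u})

/-- The transpose `∂^* : W₀^* → W₁^* ≅ W₁`. -/
def bdStar : Module.Dual ℝ T.W₀ →ₗ[ℝ] T.W₁ := transposeVia T.pairing T.nondeg T.bd

lemma pairing_bdStar (ξ : Module.Dual ℝ T.W₀) (w : T.W₁) :
    T.pairing (T.bdStar ξ) w = ξ (T.bd w) :=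
  (transposeVia_eq_iff T.nondeg).1 rfl w

lemma bd_bdStar (ξ : Module.Dual ℝ T.W₀) : T.bd (T.bdStar ξ) = 0 := by
  rw [← Module.forall_dual_apply_eq_zero_iff ℝ]
  intro ξ'
  rw [← pairing_bdStar]
  exact T.isotropic _ ⟨ξ', rfl⟩ _ ⟨ξ, rfl⟩

/-- The terms of the complex `W₀^* → W₁ → W₀`. -/
def complexX (n : ℕ) : ModuleCat.{u} ℝ :=
  match n with
  | 0 => ModuleCat.of ℝ T.W₀
  | 1 => ModuleCat.of ℝ T.W₁
  | 2 => ModuleCat.of ℝ (Module.Dual ℝ T.W₀)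
  | _ + 3 => ModuleCat.of ℝ PUnit.{u + 1}

/-- The differentials of the complex `W₀^* → W₁ → W₀`. -/
def complexD (n : ℕ) : T.complexX (n + 1) ⟶ T.complexX n :=
  match n with
  | 0 => ModuleCat.ofHom T.bd
  | 1 => ModuleCat.ofHom T.bdStar
  | _ + 2 => 0

/-- The complex `W₀^* → W₁ → W₀`, with differentials `∂^*` and `∂`. -/
def complex : ChainComplex (ModuleCat.{u} ℝ) ℕ :=
  ChainComplex.of T.complexX T.complexD fun n => by
    match n with
    | 0 => exact ModuleCat.hom_ext (LinearMap.ext T.bd_bdStar)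
    | _ + 1 => exact Limits.zero_comp

instance (n : ℕ) : FiniteDimensional ℝ (T.complex.X n) :=
  match n with
  | 0 => T.finite₀
  | 1 => T.finite₁
  | 2 => inferInstanceAs (FiniteDimensional ℝ (Module.Dual ℝ T.W₀))
  | _ + 3 => inferInstanceAs (FiniteDimensional ℝ PUnit)

instance (n : ℕ) : Subsingleton (T.complex.X (n + 3)) := inferInstanceAs (Subsingleton PUnit)

lemma exists_isLinearTwoGroupoid :
    ∃ (V : SVect.{u}) (_ : IsLinearTwoGroupoid V) (i₀ : T.W₀ ≃ₗ[ℝ] V _⦋0⦌)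
      (i₁ : T.W₁ ≃ₗ[ℝ] normPart V 1) (i₂ : Module.Dual ℝ T.W₀ ≃ₗ[ℝ] normPart V 2),
      (∀ w, face V 0 (i₁ w : V _⦋1⦌) = i₀ (T.bd w)) ∧
      ∀ ξ, normDiff V 1 (i₂ ξ) = i₁ (T.bdStar ξ) := by
  obtain ⟨V, e, he⟩ := exists_normPart_equiv T.complex
  simp only [complex, ChainComplex.of_d] at he
  have hV : IsLinearTwoGroupoid V := isLinearTwoGroupoid_of_normPart
    (fun n => Module.Finite.equiv (e n))
    fun n => (Submodule.subsingleton_iff_eq_bot).1 (e (n + 3)).symm.toEquiv.subsingleton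
  exact ⟨V, hV, e 0 ≪≫ₗ Submodule.topEquiv, e 1, e 2,
    fun w => congrArg Subtype.val (he 0 w), he 1⟩

theorem exists_hasData : ∃ G : ConstSympGpd.{u}, HasData G T := by
  obtain ⟨V, hV, i₀, i₁, i₂, hbd, hbdStar⟩ := T.exists_isLinearTwoGroupoid
  have := hV.finite 0
  let a : V _⦋0⦌ →ₗ[ℝ] normPart V 2 →ₗ[ℝ] ℝ :=
    (Module.Dual.eval ℝ T.W₀).compl₁₂ i₀.symm.toLinearMap i₂.symm.toLinearMap
  have : a.IsPerfPair := LinearMap.IsPerfPair.compl₁₂ _ i₀.symm i₂.symm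
  let b : LinearMap.BilinForm ℝ (normPart V 1) := LinearMap.BilinForm.congr i₁ T.pairing
  have hab u z : b u (normDiff V 1 z) = a (face V 0 (u : V _⦋1⦌)) z := by
    obtain ⟨w, rfl⟩ := i₁.surjective u
    obtain ⟨ξ, rfl⟩ := i₂.surjective z
    have adjoint : T.pairing w (T.bdStar ξ) = ξ (T.bd w) :=
      (T.symm.eq _ _).trans (T.pairing_bdStar ξ w)
    simpa [a, b, hbd, hbdStar] using adjoint
  obtain ⟨ω, hω, hA, hB⟩ := exists_isNormalizedCocycle (hV.normPart_eq_bot 0) a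
    (b := b) ⟨fun _ _ => T.symm.eq _ _⟩ hab
  have hnondeg : SimpliciallyNondegenerate V (constForm ω) :=
    hω.simpliciallyNondegenerate_iff.2 ⟨hA ▸ ‹a.IsPerfPair›, hB ▸ T.nondeg.congr i₁⟩
  refine ⟨⟨V, hV, ω, isSymplecticForm_constForm_iff.2 ⟨hω, hnondeg⟩⟩,
    ConstSympGpd.hasData_iff.2 ⟨i₁, i₀, fun w w' => ?_, fun w => (hbd w).symm⟩⟩
  simp [hB, b]

end LinData

theorem exists_classEquiv :
    ∃ F : Quotient ConstSympGpd.setoid.{u} ≃ Quotient LinData.setoid.{u},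
      ∀ (G : ConstSympGpd.{u}) (T : LinData.{u}),
        F (Quotient.mk _ G) = Quotient.mk _ T ↔ HasData G T := by
  let f : Quotient ConstSympGpd.setoid.{u} → Quotient LinData.setoid.{u} :=
    Quotient.map ConstSympGpd.data fun G G' hG =>
      (G.hasData_data.of_equivalent hG).isomorphic G'.hasData_data
  have hf (G : ConstSympGpd.{u}) (T : LinData.{u}) :
      f (Quotient.mk _ G) = Quotient.mk _ T ↔ HasData G T :=
    ⟨fun hT => G.hasData_data.of_isomorphic (Setoid.symm (Quotient.exact hT)),
      fun hT => Quotient.sound (G.hasData_data.isomorphic hT)⟩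
  refine ⟨Equiv.ofBijective f ⟨?_, ?_⟩, hf⟩
  · rintro ⟨G⟩ ⟨G'⟩ hG
    exact Quotient.sound (((hf G G'.data).1 hG).equivalent G'.hasData_data)
  · rintro ⟨T⟩
    obtain ⟨G, hG⟩ := T.exists_hasData
    exact ⟨Quotient.mk _ G, (hf G T).2 hG⟩

end ConstSymp

end

theorem theorem3p6 :
    -- The assignment of its tuple to a constant symplectic 2-groupoid is a bijection on classes.
    (∃ F : Quotient ConstSymp.ConstSympGpd.setoid.{u} ≃ Quotient ConstSymp.LinData.setoid.{u},
      ∀ (G : ConstSymp.ConstSympGpd.{u}) (T : ConstSymp.LinData.{u}),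
        F (Quotient.mk _ G) = Quotient.mk _ T ↔ ConstSymp.HasData G T) ∧
    -- On a fixed linear 2-groupoid, equivalences fix all data but `r` and act transitively on `r`.
    (∀ G : ConstSymp.ConstSympGpd.{u},
      (∀ ω' : LinearMap.BilinForm ℝ (G.V _⦋2⦌),
        ConstSymp.IsSymplecticForm G.V (ConstSymp.constForm ω') →
        (ConstSymp.FormEquiv G.V (ConstSymp.constForm G.ω) (ConstSymp.constForm ω') ↔
          (∀ v w, ConstSymp.pairA G.V (ConstSymp.constForm ω') 0 v w =
            ConstSymp.pairA G.V (ConstSymp.constForm G.ω) 0 v w) ∧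
          (∀ θ η, ConstSymp.pairB G.V (ConstSymp.constForm ω') 0 θ η =
            ConstSymp.pairB G.V (ConstSymp.constForm G.ω) 0 θ η))) ∧
      (∀ r : LinearMap.BilinForm ℝ (ConstSymp.kerFace G.V), r.IsAlt →
        ∃! ω' : LinearMap.BilinForm ℝ (G.V _⦋2⦌),
          ConstSymp.IsSymplecticForm G.V (ConstSymp.constForm ω') ∧
          ConstSymp.FormEquiv G.V (ConstSymp.constForm G.ω) (ConstSymp.constForm ω') ∧
          ∀ w w', ConstSymp.skewPart G.V ω' w w' = r w w')) :=
  ⟨ConstSymp.exists_classEquiv, fun G =>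
    ⟨fun _ hω' => G.isNormalizedCocycle.formEquiv_iff
        (ConstSymp.isSymplecticForm_constForm_iff.1 hω').1,
      fun _ hr => ConstSymp.existsUnique_skewPart_eq G.isSymplectic hr⟩⟩
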